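/- Let $n\ge 2$. The fan $F_n$ is the graph with vertices $v_2,\dots,v_n,v_\infty$ whose edges are $v_iv_{i+1}$ for $2\le i<n$ and $v_\infty v_i$ for $2\le i\le n$; its vertices are ordered $v_2<\dots<v_n<v_\infty$. For a spanning tree $T$ of $F_n$, $\mathrm{Greedy}(T)$ is the listing of spanning trees of $F_n$ that starts with $T$ and is continued as follows: from the current tree $T'$ pass to $T'-uv+uw$, where $(u,v,w)$ is the lexicographically smallest triple of vertices such that $uv$ is an edge of $T'$, $uw$ is an edge of $F_n$ not in $T'$, and $T'-uv+uw$ is a spanning tree of $F_n$ that is not yet in the listing; halt when there is no such triple. Let $P_n$ be the path $v_\infty,v_2,v_3,\dots,v_n$. Let $L_n$ be the last tree produced by the procedure $\mathrm{Gen}(n,1,0)$, started with the current tree $P_n$. The procedures $\mathrm{Gen}(k,s,e)$, where $s,e\in\{0,1\}$, apply moves $(u,v,w)$, replacing the current tree $T$ by $T-uv+uw$, and $\mathrm{RevGen}(k,s,e)$ performs the moves of $\mathrm{Gen}(k,s,e)$ in reverse order, each move $(u,v,w)$ being replaced by its inverse $(u,w,v)$. For each $k$, put $x=v_{k+1}$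 if $e=1$ and $x=v_\infty$ if $e=0$. - $\mathrm{Gen}(2,s,e)$: if $e=1$, apply $(v_2,v_\infty,v_3)$. - $\mathrm{Gen}(3,s,e)$: if $s=1$, apply $(v_3,v_2,x)$. Then apply $(v_2,v_\infty,v_3)$. - $\mathrm{Gen}(k,s,e)$ for $k\ge4$: if $s=1$, run $\mathrm{Gen}(k-1,1,0)$ and apply $(v_k,v_{k-1},x)$. Then run $\mathrm{RevGen}(k-1,1,0)$, apply $(v_{k-1},v_{k-2},v_k)$, run $\mathrm{Gen}(k-2,1,1)$, apply $(v_{k-2},v_{k-1},v_\infty)$ if $k>4$, and run $\mathrm{RevGen}(k-2,0,0)$. Then $L_n$ is the last tree of $\mathrm{Greedy}(P_n)$, and $\mathrm{Greedy}(L_n)$ is exactly the listing $\mathrm{Greedy}(P_n)$ in reverse order. -/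

import Mathlib

/-! ## Greedy pivot listings of spanning trees -/

section Greedy

variable {V : Type*}

/-- `T - uv + uw`: the graph obtained from `T` by deleting the edge `uv` and adding the edge `uw`. -/
def pivot (T : SimpleGraph V) (u v w : V) : SimpleGraph V :=
  T.deleteEdges {s(u, v)} ⊔ SimpleGraph.edge u w

/-- `T` is a spanning tree of `G` (`T` lives on the vertex set of `G`). -/
def IsSpanningTree (G T : SimpleGraph V) : Prop :=
  T ≤ G ∧ T.IsTree

/-- The edge move `T - uv + uw` is valid, where `gen` lists the trees generated so far: `uv` is an
edge of `T`, `uw` is an edge of `G` not in `T`, and the result is a spanning tree of `G` that has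
not been generated yet. -/
def IsValidMove (G : SimpleGraph V) (gen : List (SimpleGraph V)) (T : SimpleGraph V)
    (u v w : V) : Prop :=
  T.Adj u v ∧ G.Adj u w ∧ ¬ T.Adj u w ∧
    IsSpanningTree G (pivot T u v w) ∧ pivot T u v w ∉ gen

variable [LinearOrder V] [Fintype V]

open Classical in
/-- The valid edge moves `(u, v, w)` of `T`. The type `V ×ₗ V ×ₗ V` is ordered
lexicographically: smaller pivots `u` first, then smaller `v`, then smaller `w`. -/
noncomputable def validMoves (G : SimpleGraph V) (gen : List (SimpleGraph V))
    (T : SimpleGraph V) : Finset (V ×ₗ V ×ₗ V) :=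
  Finset.univ.filter fun m =>
    IsValidMove G gen T (ofLex m).1 (ofLex (ofLex m).2).1 (ofLex (ofLex m).2).2

theorem mem_validMoves {G : SimpleGraph V} {gen : List (SimpleGraph V)} {T : SimpleGraph V}
    {m : V ×ₗ V ×ₗ V} : m ∈ validMoves G gen T ↔
      IsValidMove G gen T (ofLex m).1 (ofLex (ofLex m).2).1 (ofLex (ofLex m).2).2 := by
  simp [validMoves]

/-- The tree produced from `T` by the smallest valid edge move, if there is a valid one. -/
noncomputable def nextTree (G : SimpleGraph V) (gen : List (SimpleGraph V))
    (T : SimpleGraph V) : Option (SimpleGraph V) :=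
  if h : (validMoves G gen T).Nonempty then
    let m := (validMoves G gen T).min' h
    some (pivot T (ofLex m).1 (ofLex (ofLex m).2).1 (ofLex (ofLex m).2).2)
  else none

theorem nextTree_not_mem {G : SimpleGraph V} {gen : List (SimpleGraph V)}
    {T T' : SimpleGraph V} (h : nextTree G gen T = some T') : T' ∉ gen := by
  unfold nextTree at h
  split_ifs at h with hne
  have hm := (validMoves G gen T).min'_mem hne
  rw [← Option.some.inj h]
  exact (mem_validMoves.mp hm).2.2.2.2

open Classical in
/-- The trees that the greedy algorithm generates after `T`, when the trees in `gen` have already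
been generated. It halts when there is no valid edge move. -/
noncomputable def greedyAfter (G : SimpleGraph V) (gen : List (SimpleGraph V))
    (T : SimpleGraph V) : List (SimpleGraph V) :=
  match h : nextTree G gen T with
  | none => []
  | some T' => T' :: greedyAfter G (T' :: gen) T'
termination_by ((Finset.univ : Finset (SimpleGraph V)) \ gen.toFinset).card
decreasing_by
  apply Finset.card_lt_card
  refine ⟨fun x hx => ?_, fun hsub => ?_⟩
  · simp only [List.toFinset_cons, Finset.mem_sdiff, Finset.mem_univ, Finset.mem_insert,
      true_and, not_or] at hx ⊢
    exact hx.2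
  · have h1 : T' ∈ (Finset.univ : Finset (SimpleGraph V)) \ gen.toFinset := by
      simpa using nextTree_not_mem h
    simpa using hsub h1

/-- The listing of spanning trees of `G` produced by the greedy algorithm started at `T`. -/
noncomputable def greedy (G T : SimpleGraph V) : List (SimpleGraph V) :=
  T :: greedyAfter G [T] T

end Greedy

/-! ## The fan graph -/

/-- The vertices `v_2 < v_3 < ⋯ < v_n < v_∞` of the fan; `v_∞` is `⊤`. -/
abbrev FanVertex (n : ℕ) : Type := WithTop (Set.Icc 2 n)

/-- The vertex `v_i` for `2 ≤ i ≤ n` (`v_∞` for all other `i`, which are never used). -/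
def fanVertex (n i : ℕ) : FanVertex n :=
  if h : i ∈ Set.Icc 2 n then ((⟨i, h⟩ : Set.Icc 2 n) : FanVertex n) else ⊤

/-- The fan `F_n`: the path `v_2, …, v_n`, and `v_∞` joined to every vertex of it. -/
def fan (n : ℕ) : SimpleGraph (FanVertex n) :=
  SimpleGraph.fromRel fun x y =>
    x = ⊤ ∨ ∃ i, 2 ≤ i ∧ i + 1 ≤ n ∧ x = fanVertex n i ∧ y = fanVertex n (i + 1)

/-- The path `P_n = v_∞, v_2, v_3, …, v_n`. -/
def fanPath (n : ℕ) : SimpleGraph (FanVertex n) :=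
  SimpleGraph.fromRel fun x y =>
    (x = ⊤ ∧ y = fanVertex n 2) ∨
      ∃ i, 2 ≤ i ∧ i + 1 ≤ n ∧ x = fanVertex n i ∧ y = fanVertex n (i + 1)

/-! ## The recursive procedure and its last tree -/

/-- Performing the edge moves of a list in reverse order: the move `T - uv + uw` is undone by
`T - uw + uv`. -/
def revMoves {V : Type*} (l : List (V × V × V)) : List (V × V × V) :=
  l.reverse.map fun m => (m.1, m.2.2, m.2.1)

/-- The sequence of edge moves performed by the recursive procedure `Gen(k, s₁, varEdge)` on
spanning trees of `F_n`; the entry `(u, v, w)` stands for `T ← T - uv + uw; Print(T)`. The moves of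
`RevGen(k, s₁, varEdge)` are `revMoves (genMoves n k s₁ varEdge)`. -/
def genMoves (n : ℕ) : ℕ → Bool → Bool → List (FanVertex n × FanVertex n × FanVertex n)
  | 0, _, _ => []
  | 1, _, _ => []
  | 2, _, varEdge =>
      if varEdge then [(fanVertex n 2, ⊤, fanVertex n 3)] else []
  | 3, s₁, varEdge =>
      (if s₁ then
        [(fanVertex n 3, fanVertex n 2, if varEdge then fanVertex n 4 else ⊤)]
      else []) ++
      [(fanVertex n 2, ⊤, fanVertex n 3)]
  | k + 4, s₁, varEdge =>
      (if s₁ then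
        genMoves n (k + 3) true false ++
        [(fanVertex n (k + 4), fanVertex n (k + 3), if varEdge then fanVertex n (k + 5) else ⊤)]
      else []) ++
      revMoves (genMoves n (k + 3) true false) ++
      [(fanVertex n (k + 3), fanVertex n (k + 2), fanVertex n (k + 4))] ++
      genMoves n (k + 2) true true ++
      (if 4 < k + 4 then [(fanVertex n (k + 2), fanVertex n (k + 3), ⊤)] else []) ++
      revMoves (genMoves n (k + 2) false false)

/-- The listing obtained by initializing `T` to `P_n`, printing `T`, and calling `Gen(n, 1, 0)`. -/
def genListing (n : ℕ) : List (SimpleGraph (FanVertex n)) :=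
  List.scanl (fun T m => pivot T m.1 m.2.1 m.2.2) (fanPath n) (genMoves n n true false)

theorem genListing_ne_nil (n : ℕ) : genListing n ≠ [] := by
  simp [genListing]

/-- The tree `L_n`: the last tree of the listing generated by `Gen(n, 1, 0)` from `P_n`. -/
def lastTree (n : ℕ) : SimpleGraph (FanVertex n) :=
  (genListing n).getLast (genListing_ne_nil n)

/-! A subgraph of the fan is a binary word read along `v_2, …, v_n`, and the spanning trees are the
words accepted by a small automaton. The automaton can be run backwards (`treeStep_injective`), so
the edges of a tree beyond `v_k` determine its state at `v_k`. Freezing those edges therefore leaves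
a family of trees that depends only on that state.

Each recursive call splits such a family by one edge at some `v_i`, either its spoke or
`v_iv_{i+1}`. Each half is a smaller family, listed forwards or backwards, and a single move at
`v_i` joins the halves. A move pivoting at an earlier vertex does not touch the deciding edge, so it
stays in the half just exhausted and yields nothing new. The few smaller moves at `v_i` itself are
unavailable, give no tree, or lead to trees already listed.

One smaller move leaves the family: replacing `v_{k-1}` by `v_{k+1}` at `v_k`. Its targets form the
exceptional set in `OpenListing`. This set is empty if `v_kv_{k+1}` is present in the start tree or
`k = n`; where the listing is used backwards in `upperListing_succ`, these trees come later.

The same argument applies to the inverse of each joining move. `TwoWayListing` records both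
conditions, so it is closed under reversal, and `TwoWayListing.greedy_eq` applies to the complete
listing and to its reverse. -/

/-! ## Codes of subgraphs of the fan -/

/-- One step of the automaton reading a subgraph of the fan from left to right. The state
`some true` says that the vertices read so far together with `v_∞` span a tree, the state
`some false` that they do so once the last vertex is joined to `v_∞`, and `none` is failure. -/
def treeStep : Option Bool → Bool → Bool → Option Bool
  | some true, true, false => some true
  | some true, false, s => some s
  | some false, true, s => some s
  | _, _, _ => none

/-- The automaton state after the vertices `v_2, …, v_i`, where `x (2 * i)` says whether the
edge `v_i v_∞` is present and `x (2 * i + 1)` whether `v_i v_{i+1}` is. -/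
def treeState (x : ℕ → Bool) : ℕ → Option Bool
  | 0 => some true
  | 1 => some true
  | i + 2 => treeStep (treeState x (i + 1)) (x (2 * i + 3)) (x (2 * i + 4))

/-- `x` codes a spanning tree of the fan `F_n`. -/
structure CodesTree (n : ℕ) (x : ℕ → Bool) : Prop where
  state : treeState x n = some true
  low : ∀ c < 4, x c = false
  high : ∀ c, 2 * n < c → x c = false

/-- `x` and `y` agree above `m`. -/
def AgreeAbove (m : ℕ) (x y : ℕ → Bool) : Prop := ∀ c, m < c → x c = y c

/-- `x` and `y` agree up to `m`. -/
def AgreeUpTo (m : ℕ) (x y : ℕ → Bool) : Prop := ∀ c, c ≤ m → x c = y c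

theorem treeState_succ (x : ℕ → Bool) {i : ℕ} (hi : 1 ≤ i) :
    treeState x (i + 1) = treeStep (treeState x i) (x (2 * i + 1)) (x (2 * i + 2)) := by
  obtain ⟨i, rfl⟩ : ∃ j, i = j + 1 := ⟨i - 1, by omega⟩
  rfl

/-- Reversibility of the automaton: once the two letters are fixed, a non-failing state has at most
one predecessor. -/
theorem treeStep_injective {a b : Option Bool} {p s c : Bool} (ha : treeStep a p s = some c)
    (hb : treeStep b p s = some c) : a = b := by
  rcases a with _ | _ | _ <;> rcases b with _ | _ | _ <;> cases p <;> cases s <;> cases c <;>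
    simp_all [treeStep]

theorem treeState_eq_of_agreeAbove {x y : ℕ → Bool} {k : ℕ} (hk : 1 ≤ k)
    (h : AgreeAbove (2 * k) x y) {m : ℕ} (hm : k ≤ m) {c : Bool}
    (hx : treeState x m = some c) (hy : treeState y m = some c) :
    treeState x k = treeState y k := by
  induction m, hm using Nat.le_induction generalizing c with
  | base => rw [hx, hy]
  | succ m hm ih =>
    have h1 := h (2 * m + 1) (by omega)
    have h2 := h (2 * m + 2) (by omega)
    rw [treeState_succ _ (by omega)] at hx hy
    rw [h1, h2] at hx
    have := treeStep_injective hx hy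
    rcases hb : treeState y m with _ | b
    · rw [hb] at hy; simp [treeStep] at hy
    · exact ih (this.trans hb) hb

theorem treeState_of_agreeAbove {x y : ℕ → Bool} {k : ℕ} (hk : 1 ≤ k)
    (h : AgreeAbove (2 * k) x y) (hxy : treeState x k = treeState y k) {m : ℕ} (hm : k ≤ m) :
    treeState x m = treeState y m := by
  induction m, hm using Nat.le_induction with
  | base => exact hxy
  | succ m hm ih =>
    rw [treeState_succ _ (by omega), treeState_succ _ (by omega), ih, h _ (by omega),
      h _ (by omega)]

theorem CodesTree.treeState_eq {n k : ℕ} {x T : ℕ → Bool} (hx : CodesTree n x)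
    (hT : CodesTree n T) (hk : 1 ≤ k) (hkn : k ≤ n) (h : AgreeAbove (2 * k) x T) :
    treeState x k = treeState T k :=
  treeState_eq_of_agreeAbove hk h hkn hx.state hT.state

/-- Surgery on trees: a prefix may be exchanged for any other reaching the same state. This
certifies the trees written down explicitly in the recursion. -/
theorem CodesTree.of_treeState_eq {n k : ℕ} {x T : ℕ → Bool} (hT : CodesTree n T) (hk : 1 ≤ k)
    (hkn : k ≤ n) (h : AgreeAbove (2 * k) x T) (hlow : ∀ c < 4, x c = false)
    (hs : treeState x k = treeState T k) : CodesTree n x where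
  state := by rw [treeState_of_agreeAbove hk h hs hkn, hT.state]
  low := hlow
  high c hc := by rw [h c (by omega), hT.high c hc]

/-! ### Codes of the first and last trees. -/

/-- The code of the path `P_n`. -/
def pathCode (c : ℕ) : Bool := decide (c = 4) || (decide (4 < c) && c % 2 == 1)

/-- The code of the tree `L_k`. -/
def lastCode : ℕ → ℕ → Bool
  | 0, _ => false
  | 1, _ => false
  | 2, c => decide (c = 4)
  | 3, c => decide (c = 5 ∨ c = 6)
  | 4, c => decide (c = 5 ∨ c = 7 ∨ c = 8)
  -- The period is three because `Gen(k + 5, ·, ·)` ends with `RevGen(k + 3, 0, 0)`, which returns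
  -- to a tree carrying `L_{k+2}` on the first `k + 2` vertices.
  | k + 5, c => if c ≤ 2 * (k + 2) then lastCode (k + 2) c else
      decide (c = 2 * (k + 3) ∨ c = 2 * (k + 4) + 1 ∨ c = 2 * (k + 5))

theorem pathCode_even {i : ℕ} (hi : 2 < i) : pathCode (2 * i) = false := by
  simp [pathCode]; omega

theorem pathCode_odd {i : ℕ} (hi : 2 ≤ i) : pathCode (2 * i + 1) = true := by
  simp [pathCode]; omega

theorem lastCode_low (k c : ℕ) (hc : c < 4) : lastCode k c = false := by
  induction k using Nat.strong_induction_on with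
  | _ k ih =>
    match k with
    | 0 => rfl
    | 1 => rfl
    | 2 => simp [lastCode]; omega
    | 3 => simp [lastCode]; omega
    | 4 => simp [lastCode]; omega
    | k + 5 => rw [lastCode, if_pos (by omega), ih _ (by omega)]

theorem treeState_pathCode {k : ℕ} {x : ℕ → Bool} (hk : 2 ≤ k)
    (h : AgreeUpTo (2 * k) x pathCode) : treeState x k = some true := by
  induction k, hk using Nat.le_induction with
  | base => simp [treeState, h 3, h 4, pathCode, treeStep]
  | succ k hk ih =>
    rw [treeState_succ _ (by omega), ih fun c hc => h c (by omega), h _ (by omega),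
      h _ (by omega), pathCode_odd hk, ← Nat.mul_succ, pathCode_even (by omega)]
    rfl

/-- Over the three new vertices the state runs through true, false, true: the first hangs on its
spoke, the second waits for the third. -/
theorem treeState_lastCode {k : ℕ} {x : ℕ → Bool} (hk : 2 ≤ k)
    (h : AgreeUpTo (2 * k) x (lastCode k)) : treeState x k = some true := by
  induction k using Nat.strong_induction_on generalizing x with
  | _ k ih =>
    match k with
    | 2 => simp [treeState, h 3, h 4, lastCode, treeStep]
    | 3 => simp [treeState, h 3, h 4, h 5, h 6, lastCode, treeStep]
    | 4 => simp [treeState, h 3, h 4, h 5, h 6, h 7, h 8, lastCode, treeStep]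
    | k + 5 =>
      have h0 : treeState x (k + 2) = some true := ih (k + 2) (by omega) (by omega) fun c hc => by
        rw [h c (by omega), lastCode, if_pos hc]
      have hl : ∀ c, 2 * (k + 2) < c → c ≤ 2 * (k + 5) → x c =
          decide (c = 2 * (k + 3) ∨ c = 2 * (k + 4) + 1 ∨ c = 2 * (k + 5)) := fun c h1 h2 => by
        rw [h c h2, lastCode, if_neg (by omega)]
      rw [treeState_succ _ (by omega), treeState_succ _ (by omega), treeState_succ _ (by omega),
        h0]
      rw [hl _ (by omega) (by omega), hl _ (by omega) (by omega), hl _ (by omega) (by omega),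
        hl _ (by omega) (by omega), hl _ (by omega) (by omega), hl _ (by omega) (by omega)]
      have e1 : decide (2 * (k + 2) + 1 = 2 * (k + 3) ∨ 2 * (k + 2) + 1 = 2 * (k + 4) + 1 ∨
        2 * (k + 2) + 1 = 2 * (k + 5)) = false := by simp; omega
      have e2 : decide (2 * (k + 2) + 2 = 2 * (k + 3) ∨ 2 * (k + 2) + 2 = 2 * (k + 4) + 1 ∨
        2 * (k + 2) + 2 = 2 * (k + 5)) = true := by simp; omega
      have e3 : decide (2 * (k + 2 + 1) + 1 = 2 * (k + 3) ∨ 2 * (k + 2 + 1) + 1 = 2 * (k + 4) + 1 ∨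
        2 * (k + 2 + 1) + 1 = 2 * (k + 5)) = false := by simp; omega
      have e4 : decide (2 * (k + 2 + 1) + 2 = 2 * (k + 3) ∨ 2 * (k + 2 + 1) + 2 = 2 * (k + 4) + 1 ∨
        2 * (k + 2 + 1) + 2 = 2 * (k + 5)) = false := by simp; omega
      have e5 : decide (2 * (k + 2 + 1 + 1) + 1 = 2 * (k + 3) ∨
        2 * (k + 2 + 1 + 1) + 1 = 2 * (k + 4) + 1 ∨
        2 * (k + 2 + 1 + 1) + 1 = 2 * (k + 5)) = true := by simp
      have e6 : decide (2 * (k + 2 + 1 + 1) + 2 = 2 * (k + 3) ∨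
        2 * (k + 2 + 1 + 1) + 2 = 2 * (k + 4) + 1 ∨
        2 * (k + 2 + 1 + 1) + 2 = 2 * (k + 5)) = true := by simp; omega
      rw [e1, e2, e3, e4, e5, e6]
      rfl

theorem lastCode_top {k : ℕ} (hk : 3 ≤ k) : lastCode k (2 * k) = true := by
  match k with
  | 3 => rfl
  | 4 => rfl
  | k + 5 => rw [lastCode, if_neg (by omega)]; simp

theorem lastCode_pred {k : ℕ} (hk : 2 ≤ k) : lastCode (k + 1) (2 * k + 1) = true := by
  match k with
  | 2 => rfl
  | 3 => rfl
  | k + 4 => rw [lastCode, if_neg (by omega)]; simp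

/-! ## Moves and two-way greedy listings -/

/-- The code of the edge from `v_i` to `v_{i-1}`, `v_{i+1}` or `v_∞`, for directions `0`, `1`,
`2`. -/
def dirCode (i : ℕ) : Fin 3 → ℕ
  | 0 => 2 * i - 1
  | 1 => 2 * i + 1
  | 2 => 2 * i

/-- The neighbour of `v_i` in the given direction. -/
def dirVertex (n i : ℕ) : Fin 3 → FanVertex n
  | 0 => fanVertex n (i - 1)
  | 1 => fanVertex n (i + 1)
  | 2 => ⊤

/-- `y` is obtained from `x` by replacing the edge at `v_i` in direction `d` by the one in
direction `d'`. -/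
structure IsCodeMove (x y : ℕ → Bool) (i : ℕ) (d d' : Fin 3) : Prop where
  old_left : x (dirCode i d) = true
  old_right : y (dirCode i d) = false
  new_left : x (dirCode i d') = false
  new_right : y (dirCode i d') = true
  same : ∀ c, c ≠ dirCode i d → c ≠ dirCode i d' → y c = x c

theorem IsCodeMove.symm {x y : ℕ → Bool} {i : ℕ} {d d' : Fin 3} (h : IsCodeMove x y i d d') :
    IsCodeMove y x i d' d :=
  ⟨h.new_right, h.new_left, h.old_right, h.old_left, fun c h1 h2 => (h.same c h2 h1).symm⟩

/-- The lexicographic order on moves. -/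
def MoveLT (j : ℕ) (e e' : Fin 3) (i : ℕ) (d d' : Fin 3) : Prop :=
  j < i ∨ j = i ∧ (e < d ∨ e = d ∧ e' < d')

/-- Every move from `T` smaller than `(i, d, d')` that leads to a tree leads to an element of
`S`. -/
def SmallerMovesIn (n : ℕ) (T : ℕ → Bool) (i : ℕ) (d d' : Fin 3) (S : Set (ℕ → Bool)) : Prop :=
  ∀ j e e' x, MoveLT j e e' i d d' → IsCodeMove T x j e e' → CodesTree n x → x ∈ S

/-- `l` is a listing of trees from `T` to `T'` by the moves `ms`, such that every tree reached by a
move smaller than the one performed is in `B` or earlier in the list, and every tree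
reached by a move smaller than the inverse of the one just performed is in `A` or later in the
list. -/
inductive TwoWayListing (n : ℕ) : (ℕ → Bool) → (ℕ → Bool) → List (ℕ → Bool) →
    List (FanVertex n × FanVertex n × FanVertex n) → Set (ℕ → Bool) → Set (ℕ → Bool) → Prop
  | single {T : ℕ → Bool} {B A : Set (ℕ → Bool)} (hT : CodesTree n T) :
      TwoWayListing n T T [T] [] B A
  | join {T₁ T₂ T₃ T₄ : ℕ → Bool} {l₁ l₂ : List (ℕ → Bool)}
      {ms₁ ms₂ : List (FanVertex n × FanVertex n × FanVertex n)} {B A : Set (ℕ → Bool)}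
      {i : ℕ} {d d' : Fin 3}
      (h₁ : TwoWayListing n T₁ T₂ l₁ ms₁ B (A ∪ {x | x ∈ l₂}))
      (h₂ : TwoWayListing n T₃ T₄ l₂ ms₂ (B ∪ {x | x ∈ l₁}) A)
      (hi : 2 ≤ i) (hin : i ≤ n) (hm : IsCodeMove T₂ T₃ i d d') (hdis : l₁.Disjoint l₂)
      (hF : SmallerMovesIn n T₂ i d d' (B ∪ {x | x ∈ l₁}))
      (hR : SmallerMovesIn n T₃ i d' d (A ∪ {x | x ∈ l₂})) :
      TwoWayListing n T₁ T₄ (l₁ ++ l₂)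
        (ms₁ ++ (fanVertex n i, dirVertex n i d, dirVertex n i d') :: ms₂) B A

namespace TwoWayListing

variable {n : ℕ} {T T' : ℕ → Bool} {l : List (ℕ → Bool)}
  {ms : List (FanVertex n × FanVertex n × FanVertex n)} {B A : Set (ℕ → Bool)}

theorem mono (h : TwoWayListing n T T' l ms B A) {B' A' : Set (ℕ → Bool)} (hB : B ⊆ B')
    (hA : A ⊆ A') : TwoWayListing n T T' l ms B' A' := by
  induction h generalizing B' A' with
  | single hT => exact single hT
  | join h₁ h₂ hi hin hm hdis hF hR ih₁ ih₂ =>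
    exact join (ih₁ hB (Set.union_subset_union_left _ hA))
      (ih₂ (Set.union_subset_union_left _ hB) hA) hi hin hm hdis
      (fun j e e' x h1 h2 h3 => Set.union_subset_union_left _ hB (hF j e e' x h1 h2 h3))
      (fun j e e' x h1 h2 h3 => Set.union_subset_union_left _ hA (hR j e e' x h1 h2 h3))

theorem revMoves_append_cons {V : Type*} (l₁ l₂ : List (V × V × V)) (m : V × V × V) :
    revMoves (l₁ ++ m :: l₂) = revMoves l₂ ++ (m.1, m.2.2, m.2.1) :: revMoves l₁ := by
  simp [revMoves]

/-- Reversal exchanges the two minimality conditions together with the sets `B` and `A`. This covers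
every `RevGen` call. -/
theorem rev (h : TwoWayListing n T T' l ms B A) :
    TwoWayListing n T' T l.reverse (revMoves ms) A B := by
  induction h with
  | single hT => exact single hT
  | join h₁ h₂ hi hin hm hdis hF hR ih₁ ih₂ =>
    rw [List.reverse_append, revMoves_append_cons]
    refine join ?_ ?_ hi hin hm.symm ?_ ?_ ?_
    · simpa using ih₂
    · simpa using ih₁
    · intro x hx hx'
      exact hdis (by simpa using hx') (by simpa using hx)
    · simpa using hR
    · simpa using hF

theorem start_cons (h : TwoWayListing n T T' l ms B A) : ∃ t, l = T :: t := by
  induction h with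
  | single hT => exact ⟨[], rfl⟩
  | join h₁ h₂ hi hin hm hdis hF hR ih₁ ih₂ =>
    obtain ⟨t, rfl⟩ := ih₁
    exact ⟨_, rfl⟩

theorem getLast?_eq (h : TwoWayListing n T T' l ms B A) : l.getLast? = some T' := by
  obtain ⟨t, ht⟩ := h.rev.start_cons
  rw [← List.head?_reverse, ht]
  rfl

theorem codesTree (h : TwoWayListing n T T' l ms B A) : ∀ x ∈ l, CodesTree n x := by
  induction h with
  | single hT => simpa using hT
  | join h₁ h₂ hi hin hm hdis hF hR ih₁ ih₂ =>
    intro x hx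
    rcases List.mem_append.1 hx with hx | hx
    exacts [ih₁ x hx, ih₂ x hx]

theorem end_mem (h : TwoWayListing n T T' l ms B A) : T' ∈ l :=
  List.mem_of_getLast? h.getLast?_eq

theorem start_mem (h : TwoWayListing n T T' l ms B A) : T ∈ l :=
  List.mem_reverse.1 h.rev.end_mem

end TwoWayListing

/-! ## The recursive procedure is greedy in both directions -/

/-- A pivot at `v_i` involves only the codes `2i - 1`, `2i`, `2i + 1`. Hence a pivot at an earlier
vertex preserves the edge by which a family is split. -/
theorem IsCodeMove.agreeAbove {x y : ℕ → Bool} {i : ℕ} {d d' : Fin 3}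
    (h : IsCodeMove x y i d d') {m : ℕ} (hm : 2 * i + 1 ≤ m) : AgreeAbove m y x := by
  intro c hc
  apply h.same
  · fin_cases d <;> simp only [dirCode] <;> omega
  · fin_cases d' <;> simp only [dirCode] <;> omega

theorem IsCodeMove.ne {x y : ℕ → Bool} {i : ℕ} {d d' : Fin 3} (h : IsCodeMove x y i d d') :
    d ≠ d' := by
  rintro rfl
  exact absurd (h.old_left.symm.trans h.new_left) (by simp)

theorem treeState_ne_of_spoke {x : ℕ → Bool} {j : ℕ} (hj : 1 ≤ j) (h : x (2 * j + 2) = true) :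
    treeState x (j + 1) ≠ some false := by
  rw [treeState_succ x hj, h]
  rcases treeState x j with _ | _ | _ <;> cases x (2 * j + 1) <;> simp [treeStep]

theorem treeState_ne_of_isolated {x : ℕ → Bool} {j : ℕ} (hj : 1 ≤ j)
    (h : x (2 * j + 1) = false) (h' : x (2 * j + 2) = false) :
    treeState x (j + 1) ≠ some true := by
  rw [treeState_succ x hj, h, h']
  rcases treeState x j with _ | _ | _ <;> simp [treeStep]

/-- If the first `j + 1` vertices of `T` form a tree that is not joined to `v_{j+2}`, then no tree
that agrees with `T` further on contains both the spoke at `v_{j+1}` and the edge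
`v_{j+1}v_{j+2}`. -/
theorem CodesTree.not_spoke_and_path {n j : ℕ} {x T : ℕ → Bool} (hx : CodesTree n x)
    (hT : CodesTree n T) (hj : 1 ≤ j) (hjn : j + 1 < n) (hs : treeState T (j + 1) = some true)
    (hp : T (2 * j + 3) = false) (h : AgreeAbove (2 * j + 3) x T) (h1 : x (2 * j + 2) = true)
    (h2 : x (2 * j + 3) = true) : False := by
  -- The state of `T` at `v_{j+2}` is the value of the spoke there. For `x` the spoke at `v_{j+1}`
  -- rules out the pending state, so the path edge leads either to failure or to the opposite value.
  have e := hx.treeState_eq hT (k := j + 2) (by omega) (by omega) fun c hc => h c (by omega)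
  have hn := treeState_ne_of_spoke hj h1
  rw [treeState_succ x (by omega), treeState_succ T (by omega), hs] at e
  change treeStep _ (x (2 * j + 3)) (x (2 * j + 4)) =
    treeStep _ (T (2 * j + 3)) (T (2 * j + 4)) at e
  rw [h2, hp, h (2 * j + 4) (by omega)] at e
  rcases hr : treeState x (j + 1) with _ | _ | _ <;> cases hs' : T (2 * j + 4) <;>
    simp_all [treeStep]

theorem treeState_ne_none {x : ℕ → Bool} {k n : ℕ} (hk : 1 ≤ k) (hkn : k ≤ n)
    (h : treeState x n ≠ none) : treeState x k ≠ none := by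
  induction n, hkn using Nat.le_induction with
  | base => exact h
  | succ n hn ih =>
    refine ih fun h0 => h ?_
    rw [treeState_succ _ (by omega), h0]
    rfl

/-! ### The families of trees visited by the recursive calls. -/

/-- The listing of all trees that agree with the start tree outside the first `k` vertices. -/
def OpenListing (n k : ℕ) : Prop :=
  ∀ T T', CodesTree n T → AgreeUpTo (2 * k) T pathCode → AgreeUpTo (2 * k) T' (lastCode k) →
    AgreeAbove (2 * k) T' T →
    ∃ l, TwoWayListing n T T' l (genMoves n k true false)
      {x | T (2 * k + 1) = false ∧ CodesTree n x ∧ x (2 * k + 1) = true ∧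
        AgreeAbove (2 * k + 1) x T} ∅ ∧
      ∀ x, x ∈ l ↔ CodesTree n x ∧ AgreeAbove (2 * k) x T

/-- The listing of the same trees with the edge `v_k v_{k+1}` in the role of the spoke at `v_k`. -/
def LinkedListing (n k : ℕ) : Prop :=
  ∀ T T', CodesTree n T → AgreeUpTo (2 * k) T pathCode → T (2 * k + 1) = false →
    (∀ c < 2 * k, T' c = lastCode k c) → T' (2 * k) = false → T' (2 * k + 1) = true →
    AgreeAbove (2 * k + 1) T' T →
    ∃ l, TwoWayListing n T T' l (genMoves n k true true) ∅ ∅ ∧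
      ∀ x, x ∈ l ↔ CodesTree n x ∧ x (2 * k) = false ∧ AgreeAbove (2 * k + 1) x T

/-- The part of the listing in which the last edge at `v_{k+1}` is present. -/
def UpperListing (n k : ℕ) : Prop :=
  ∀ e T T', CodesTree n T → AgreeUpTo (2 * k) T (lastCode k) → T (2 * k + 1) = false →
    AgreeUpTo (2 * k + 1) T' (lastCode (k + 1)) → AgreeAbove (2 * k + 1) T' T →
    ∃ l, TwoWayListing n T T' l (genMoves n (k + 1) false e) ∅ ∅ ∧
      ∀ x, x ∈ l ↔ CodesTree n x ∧ AgreeAbove (2 * k + 1) x T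

/-- The part of the listing in which both path edges at `v_{j+1}` are present or the edge
`v_j v_{j+1}` serves as an alternative spoke. -/
def InnerListing (n j : ℕ) : Prop :=
  ∀ T T', CodesTree n T → AgreeUpTo (2 * j) T pathCode → T (2 * j + 1) = false →
    AgreeUpTo (2 * j + 1) T' (lastCode (j + 2)) → AgreeAbove (2 * j + 1) T' T →
    ∃ l, TwoWayListing n T T' l
      (genMoves n j true true ++ (if 2 < j then [(fanVertex n j, fanVertex n (j + 1), ⊤)] else []) ++
        revMoves (genMoves n j false false)) ∅ ∅ ∧
      ∀ x, x ∈ l ↔ CodesTree n x ∧ AgreeAbove (2 * j + 1) x T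

/-- This brings a call with `s = 1` into the shape of `TwoWayListing.join`; the separate clause for
`k = 3` fits the same pattern. -/
theorem genMoves_true (n m : ℕ) (hm : 2 ≤ m) (e : Bool) :
    genMoves n (m + 1) true e = genMoves n m true false ++
      (fanVertex n (m + 1), dirVertex n (m + 1) 0, dirVertex n (m + 1) (if e then 1 else 2)) ::
        genMoves n (m + 1) false e := by
  match m with
  | 2 => cases e <;> simp [genMoves, dirVertex]
  | m + 3 => cases e <;> simp [genMoves, dirVertex]

theorem genMoves_false (n m : ℕ) (e : Bool) :
    genMoves n (m + 4) false e = revMoves (genMoves n (m + 3) true false) ++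
      (fanVertex n (m + 3), dirVertex n (m + 3) 0, dirVertex n (m + 3) 1) ::
        (genMoves n (m + 2) true true ++
          (if 2 < m + 2 then [(fanVertex n (m + 2), fanVertex n (m + 3), ⊤)] else []) ++
          revMoves (genMoves n (m + 2) false false)) := by
  simp [genMoves, dirVertex]

/-! ### Splitting each family by one edge. -/

theorem openListing_two {n : ℕ} (hn : 2 ≤ n) : OpenListing n 2 := by
  intro T T' hT hP hL hA
  have : T' = T := by
    funext c
    by_cases hc : c ≤ 4
    · rw [hL c hc, hP c hc]
      simp [lastCode, pathCode]; omega
    · exact hA c (by omega)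
  subst this
  refine ⟨[T'], TwoWayListing.single hT, fun x => ?_⟩
  rw [List.mem_singleton]
  refine ⟨?_, ?_⟩
  · rintro rfl
    exact ⟨hT, fun _ _ => rfl⟩
  · rintro ⟨hx, hxT⟩
    have e := hx.treeState_eq hT (k := 2) (by omega) hn hxT
    simp only [treeState, mul_zero, zero_add, hx.low 3 (by omega), hT.low 3 (by omega), treeStep,
      Option.some.injEq] at e
    funext c
    rcases lt_trichotomy c 4 with h | rfl | h
    · rw [hx.low c h, hT.low c h]
    · exact e
    · exact hxT c h

/-- The split is by the spoke at `v_{m+1}`. Without it the edge `v_mv_{m+1}` is forced, since the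
prefix must reach the state `some true`, and the first `m` vertices form an open family. -/
theorem openListing_succ {n m : ℕ} (hm : 2 ≤ m) (hmn : m < n) (hG : OpenListing n m)
    (hH : UpperListing n m) : OpenListing n (m + 1) := by
  intro T T' hT hP hL hA
  have hTs : treeState T (m + 1) = some true := treeState_pathCode (by omega) hP
  have p1 : T (2 * m + 1) = true := by rw [hP (2 * m + 1) (by omega), pathCode_odd hm]
  have p2 : T (2 * m + 2) = false := by
    rw [hP (2 * m + 2) (by omega)]
    exact pathCode_even (i := m + 1) (by omega)
  obtain ⟨T₁, h1a, h1b⟩ : ∃ T₁, AgreeUpTo (2 * m) T₁ (lastCode m) ∧ AgreeAbove (2 * m) T₁ T :=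
    ⟨fun c => if c ≤ 2 * m then lastCode m c else T c, fun c hc => if_pos hc,
      fun c hc => if_neg (by omega)⟩
  obtain ⟨T₂, h2a, h2b, h2c, h2d⟩ : ∃ T₂, AgreeUpTo (2 * m) T₂ (lastCode m) ∧
      T₂ (2 * m + 1) = false ∧ T₂ (2 * m + 2) = true ∧ AgreeAbove (2 * m + 2) T₂ T :=
    ⟨fun c => if c ≤ 2 * m then lastCode m c else if c = 2 * m + 1 then false else
      if c = 2 * m + 2 then true else T c, fun c hc => if_pos hc, by simp, by simp,
      fun c hc => by simp (disch := omega) only [if_neg]⟩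
  have hT2 : CodesTree n T₂ := by
    refine hT.of_treeState_eq (k := m + 1) (by omega) hmn h2d
      (fun c hc => by rw [h2a c (by omega), lastCode_low m c hc]) ?_
    rw [hTs, treeState_succ _ (by omega), treeState_lastCode hm h2a, h2b, h2c]
    rfl
  obtain ⟨l₁, hl₁, mem₁⟩ := hG T T₁ hT (fun c hc => hP c (by omega)) h1a h1b
  obtain ⟨l₂, hl₂, mem₂⟩ := hH false T₂ T' hT2 h2a h2b (fun c hc => hL c (by omega))
    (fun c hc => by
      rcases eq_or_ne c (2 * m + 2) with rfl | hne
      · rw [h2c, hL _ (by omega)]; exact lastCode_top (by omega)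
      · rw [hA c (by omega), h2d c (by omega)])
  have key : ∀ x, CodesTree n x → AgreeAbove (2 * m + 2) x T → x (2 * m + 2) = false → x ∈ l₁ := by
    intro x hx hxT h0
    refine (mem₁ x).2 ⟨hx, fun c hc => ?_⟩
    have e : treeState x (m + 1) = some true :=
      (hx.treeState_eq hT (by omega) hmn hxT).trans hTs
    rcases lt_trichotomy c (2 * m + 2) with h | rfl | h
    · obtain rfl : c = 2 * m + 1 := by omega
      rw [p1]
      by_contra hne
      exact treeState_ne_of_isolated (by omega) (by simpa using hne) h0 e
    · rw [h0, p2]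
    · exact hxT c h
  have key2 : ∀ x, CodesTree n x → AgreeAbove (2 * m + 2) x T → x (2 * m + 2) = true → x ∈ l₂ := by
    intro x hx hxT h0
    refine (mem₂ x).2 ⟨hx, fun c hc => ?_⟩
    rcases eq_or_ne c (2 * m + 2) with rfl | hne
    · rw [h0, h2c]
    · rw [hxT c (by omega), h2d c (by omega)]
  have mv : IsCodeMove T₁ T₂ (m + 1) 0 2 := by
    refine ⟨?_, h2b, ?_, h2c, fun c hc hc' => ?_⟩
    · exact (h1b (2 * m + 1) (by omega)).trans p1
    · exact (h1b (2 * m + 2) (by omega)).trans p2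
    · simp only [dirCode] at hc hc'
      by_cases h : c ≤ 2 * m
      · rw [h2a c h, h1a c h]
      · rw [h2d c (by omega), h1b c (by omega)]
  refine ⟨l₁ ++ l₂, ?_, fun x => ?_⟩
  · have hg := genMoves_true n m hm false
    simp only [Bool.false_eq_true, if_false] at hg
    rw [hg]
    refine TwoWayListing.join (hl₁.mono ?_ (by simp)) (hl₂.mono (by simp) subset_rfl) (by omega)
      (by omega) mv ?_ ?_ ?_
    -- The exceptional set of the inner call is empty, because `v_mv_{m+1}` is an edge of `T`.
    · rintro x ⟨h, -⟩
      simp [p1] at h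
    · intro x hx hx'
      have := ((mem₁ x).1 hx).2 (2 * m + 2) (by omega)
      rw [((mem₂ x).1 hx').2 (2 * m + 2) (by omega), h2c, p2] at this
      cases this
    · intro j e e' x hlt hmv hx
      rcases hlt with h | ⟨rfl, h⟩
      · have ha := hmv.agreeAbove (m := 2 * m + 1) (by omega)
        refine Or.inr (key x hx (fun c hc => ?_) ?_)
        · rw [ha c (by omega), h1b c (by omega)]
        · rw [ha _ (by omega), h1b _ (by omega), p2]
      -- The only smaller move at `v_{m+1}` itself adds `v_{m+1}v_{m+2}` and leaves the family; its
      -- result lies in the exceptional set.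
      · obtain ⟨rfl, rfl⟩ : e = 0 ∧ e' = 1 := by
          exact (by decide : ∀ e e' : Fin 3, e < 0 ∨ e = 0 ∧ e' < 2 → e ≠ e' → e = 0 ∧ e' = 1)
            e e' h hmv.ne
        have hn : T₁ (2 * m + 3) = false := hmv.new_left
        have hn' : x (2 * m + 3) = true := hmv.new_right
        refine Or.inl ⟨?_, hx, hn', fun c hc => ?_⟩
        · exact (h1b (2 * m + 3) (by omega)).symm.trans hn
        · rw [hmv.same c (by simp only [dirCode]; omega) (by simp only [dirCode]; omega),
            h1b c (by omega)]
    · intro j e e' x hlt hmv hx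
      rcases hlt with h | ⟨rfl, h⟩
      · have ha := hmv.agreeAbove (m := 2 * m + 1) (by omega)
        exact Or.inr ((mem₂ x).2 ⟨hx, ha⟩)
      -- The edge to `v_m` is absent and the spoke is already present. The remaining move, from
      -- `v_{m+2}` to `v_m`, would give `v_{m+1}` a second connection to `v_∞`.
      · rcases (by decide : ∀ e e' : Fin 3, e < 2 ∨ e = 2 ∧ e' < 0 → e ≠ e' →
            e = 0 ∨ e = 1 ∧ e' = 0 ∨ e = 1 ∧ e' = 2) e e' h hmv.ne with
            rfl | ⟨rfl, rfl⟩ | ⟨rfl, rfl⟩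
        · exact absurd (hmv.old_left.symm.trans h2b) (by simp)
        · have e1 : x (2 * m + 1) = true := hmv.new_right
          have e2 : x (2 * m + 2) = true := (hmv.same (2 * m + 2) (by simp only [dirCode]; omega)
            (by simp only [dirCode]; omega)).trans h2c
          refine absurd ?_ (treeState_ne_none (x := x) (k := m + 1) (by omega) hmn
            (by simp [hx.state]))
          rw [treeState_succ _ (by omega), e1, e2, treeState_lastCode hm fun c hc => ?_]
          · rfl
          · rw [hmv.same c (by simp only [dirCode]; omega) (by simp only [dirCode]; omega),
              h2a c hc]
        · exact absurd (hmv.new_left.symm.trans h2c) (by simp)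
  · rw [List.mem_append]
    constructor
    · rintro (h | h)
      · exact ⟨((mem₁ x).1 h).1, fun c hc => ((mem₁ x).1 h).2 c (by omega)⟩
      · refine ⟨((mem₂ x).1 h).1, fun c hc => ?_⟩
        rw [((mem₂ x).1 h).2 c (by omega), h2d c (by omega)]
    · rintro ⟨hx, hxT⟩
      cases h0 : x (2 * m + 2)
      · exact Or.inl (key x hx hxT h0)
      · exact Or.inr (key2 x hx hxT h0)

/-- Here the split is by `v_{m+1}v_{m+2}`. The joining move is the first possible one at `v_{m+1}`,
so no exceptional set is needed. -/
theorem linkedListing_succ {n m : ℕ} (hm : 2 ≤ m) (hmn : m + 1 < n) (hG : OpenListing n m)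
    (hH : UpperListing n m) : LinkedListing n (m + 1) := by
  intro T T' hT hP hp hL hL1 hL2 hA
  have hTs : treeState T (m + 1) = some true := treeState_pathCode (by omega) hP
  have p1 : T (2 * m + 1) = true := by rw [hP (2 * m + 1) (by omega), pathCode_odd hm]
  have p2 : T (2 * m + 2) = false := by
    rw [hP (2 * m + 2) (by omega)]
    exact pathCode_even (i := m + 1) (by omega)
  have p3 : T (2 * m + 3) = false := hp
  obtain ⟨T₁, h1a, h1b⟩ : ∃ T₁, AgreeUpTo (2 * m) T₁ (lastCode m) ∧ AgreeAbove (2 * m) T₁ T :=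
    ⟨fun c => if c ≤ 2 * m then lastCode m c else T c, fun c hc => if_pos hc,
      fun c hc => if_neg (by omega)⟩
  obtain ⟨T₂, h2a, h2b, h2c, h2e, h2d⟩ : ∃ T₂, AgreeUpTo (2 * m) T₂ (lastCode m) ∧
      T₂ (2 * m + 1) = false ∧ T₂ (2 * m + 3) = true ∧ T₂ (2 * m + 2) = false ∧
      AgreeAbove (2 * m + 3) T₂ T :=
    ⟨fun c => if c ≤ 2 * m then lastCode m c else if c = 2 * m + 1 then false else
      if c = 2 * m + 3 then true else T c, fun c hc => if_pos hc, by simp, by simp, by simp [p2],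
      fun c hc => by simp (disch := omega) only [if_neg]⟩
  -- The edge `v_{m+1}v_{m+2}` changes as well, so the states are compared only at `v_{m+2}`.
  have hT2 : CodesTree n T₂ := by
    refine hT.of_treeState_eq (k := m + 2) (by omega) hmn (fun c hc => h2d c (by omega))
      (fun c hc => by rw [h2a c (by omega), lastCode_low m c hc]) ?_
    rw [treeState_succ T (by omega), hTs, treeState_succ _ (by omega), treeState_succ _ (by omega),
      treeState_lastCode hm h2a, h2b, h2e]
    change treeStep _ (T₂ (2 * m + 3)) (T₂ (2 * m + 4)) =
      treeStep _ (T (2 * m + 3)) (T (2 * m + 4))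
    rw [h2c, p3, h2d _ (by omega)]
    rfl
  obtain ⟨l₁, hl₁, mem₁⟩ := hG T T₁ hT (fun c hc => hP c (by omega)) h1a h1b
  obtain ⟨l₂, hl₂, mem₂⟩ := hH true T₂ T' hT2 h2a h2b (fun c hc => hL c (by omega))
    (fun c hc => by
      rcases eq_or_ne c (2 * m + 2) with rfl | hne
      · rw [h2e]; exact hL1
      · rcases eq_or_ne c (2 * m + 3) with rfl | hne'
        · rw [h2c]; exact hL2
        · rw [hA c (by omega), h2d c (by omega)])
  have key : ∀ x, CodesTree n x → AgreeAbove (2 * m + 3) x T → x (2 * m + 2) = false →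
      x (2 * m + 3) = false → x ∈ l₁ := by
    intro x hx hxT h0 h3
    refine (mem₁ x).2 ⟨hx, fun c hc => ?_⟩
    have e : treeState x (m + 1) = some true :=
      (hx.treeState_eq hT (by omega) (by omega) fun c hc => by
        rcases eq_or_ne c (2 * m + 3) with rfl | hne
        · rw [h3, p3]
        · exact hxT c (by omega)).trans hTs
    by_cases h : c = 2 * m + 1
    · subst h
      rw [p1]
      by_contra hne
      exact treeState_ne_of_isolated (by omega) (by simpa using hne) h0 e
    · by_cases h' : c = 2 * m + 2
      · rw [h', h0, p2]
      · by_cases h'' : c = 2 * m + 3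
        · rw [h'', h3, p3]
        · exact hxT c (by omega)
  have key2 : ∀ x, CodesTree n x → AgreeAbove (2 * m + 3) x T → x (2 * m + 2) = false →
      x (2 * m + 3) = true → x ∈ l₂ := by
    intro x hx hxT h0 h3
    refine (mem₂ x).2 ⟨hx, fun c hc => ?_⟩
    rcases eq_or_ne c (2 * m + 2) with rfl | hne
    · rw [h0, h2e]
    · rcases eq_or_ne c (2 * m + 3) with rfl | hne'
      · rw [h3, h2c]
      · rw [hxT c (by omega), h2d c (by omega)]
  have mv : IsCodeMove T₁ T₂ (m + 1) 0 1 := by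
    refine ⟨?_, h2b, ?_, h2c, fun c hc hc' => ?_⟩
    · exact (h1b (2 * m + 1) (by omega)).trans p1
    · exact (h1b (2 * m + 3) (by omega)).trans p3
    · simp only [dirCode] at hc hc'
      by_cases h : c ≤ 2 * m
      · rw [h2a c h, h1a c h]
      · by_cases h' : c = 2 * m + 2
        · rw [h', h2e, h1b _ (by omega), p2]
        · rw [h2d c (by omega), h1b c (by omega)]
  refine ⟨l₁ ++ l₂, ?_, fun x => ?_⟩
  · have hg := genMoves_true n m hm true
    simp only [if_true] at hg
    rw [hg]
    refine TwoWayListing.join (hl₁.mono ?_ (by simp)) (hl₂.mono (by simp) subset_rfl) (by omega)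
      (by omega) mv ?_ ?_ ?_
    · rintro x ⟨h, -⟩
      simp [p1] at h
    · intro x hx hx'
      have := ((mem₁ x).1 hx).2 (2 * m + 3) (by omega)
      rw [((mem₂ x).1 hx').2 (2 * m + 3) (by omega), h2c, p3] at this
      cases this
    · intro j e e' x hlt hmv hx
      rcases hlt with h | ⟨rfl, h⟩
      · have ha := hmv.agreeAbove (m := 2 * m + 1) (by omega)
        refine Or.inr (key x hx (fun c hc => ?_) ?_ ?_)
        · rw [ha c (by omega), h1b c (by omega)]
        · rw [ha _ (by omega), h1b _ (by omega), p2]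
        · rw [ha _ (by omega), h1b _ (by omega), p3]
      · exact absurd hmv.ne ((by decide : ∀ e e' : Fin 3, e < 0 ∨ e = 0 ∧ e' < 1 → ¬ e ≠ e') e e' h)
    · intro j e e' x hlt hmv hx
      rcases hlt with h | ⟨rfl, h⟩
      · have ha := hmv.agreeAbove (m := 2 * m + 1) (by omega)
        exact Or.inr ((mem₂ x).2 ⟨hx, ha⟩)
      · obtain rfl := (by decide : ∀ e e' : Fin 3, e < 1 ∨ e = 1 ∧ e' < 0 → e = 0) e e' h
        exact absurd (hmv.old_left.symm.trans h2b) (by simp)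
  · rw [List.mem_append]
    constructor
    · rintro (h | h)
      · exact ⟨((mem₁ x).1 h).1, (((mem₁ x).1 h).2 _ (by omega)).trans p2,
          fun c hc => ((mem₁ x).1 h).2 c (by omega)⟩
      · refine ⟨((mem₂ x).1 h).1, (((mem₂ x).1 h).2 _ (by omega)).trans h2e, fun c hc => ?_⟩
        rw [((mem₂ x).1 h).2 c (by omega), h2d c (by omega)]
    · rintro ⟨hx, h2, hxT⟩
      cases h0 : x (2 * m + 3)
      · exact Or.inl (key x hx hxT h2 h0)
      · exact Or.inr (key2 x hx hxT h2 h0)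

theorem lastCode_add_two_spoke {j : ℕ} (hj : 2 ≤ j) : lastCode (j + 2) (2 * j + 2) = false := by
  match j with
  | 2 => rfl
  | j + 3 => rw [lastCode, if_neg (by omega)]; simp; omega

/-- The split is by `v_{j+1}v_{j+2}`. Without this edge the family is an open one, run backwards;
with it the spoke at `v_{j+1}` is impossible (`CodesTree.not_spoke_and_path`) and `InnerListing`
takes over. -/
theorem upperListing_succ {n j : ℕ} (hj : 2 ≤ j) (hjn : j + 1 < n) (hG : OpenListing n (j + 1))
    (hM : InnerListing n j) : UpperListing n (j + 1) := by
  intro e T T' hT hP hp hL hA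
  have p3 : T (2 * j + 3) = false := hp
  have hTs : treeState T (j + 1) = some true := treeState_lastCode (by omega) hP
  obtain ⟨T₁, h1a, h1b⟩ : ∃ T₁, AgreeUpTo (2 * j + 2) T₁ pathCode ∧
      AgreeAbove (2 * j + 2) T₁ T :=
    ⟨fun c => if c ≤ 2 * j + 2 then pathCode c else T c, fun c hc => if_pos hc,
      fun c hc => if_neg (by omega)⟩
  obtain ⟨T₂, h2a, h2b, h2c, h2e, h2d⟩ : ∃ T₂, AgreeUpTo (2 * j) T₂ pathCode ∧
      T₂ (2 * j + 1) = false ∧ T₂ (2 * j + 3) = true ∧ T₂ (2 * j + 2) = false ∧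
      AgreeAbove (2 * j + 3) T₂ T :=
    ⟨fun c => if c ≤ 2 * j then pathCode c else if c = 2 * j + 1 then false else
      if c = 2 * j + 3 then true else if c = 2 * j + 2 then false else T c,
      fun c hc => if_pos hc, by simp, by simp, by simp,
      fun c hc => by simp (disch := omega) only [if_neg]⟩
  have low : ∀ c < 4, pathCode c = false := by decide
  have hT1 : CodesTree n T₁ := by
    refine hT.of_treeState_eq (k := j + 1) (by omega) (by omega) h1b
      (fun c hc => by rw [h1a c (by omega), low c hc]) ?_
    rw [hTs, treeState_pathCode (by omega) h1a]
  have hT2 : CodesTree n T₂ := by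
    refine hT.of_treeState_eq (k := j + 2) (by omega) hjn (fun c hc => h2d c (by omega))
      (fun c hc => by rw [h2a c (by omega), low c hc]) ?_
    rw [treeState_succ T (by omega), hTs, treeState_succ _ (by omega), treeState_succ _ (by omega),
      treeState_pathCode hj h2a, h2b, h2e]
    change treeStep _ (T₂ (2 * j + 3)) (T₂ (2 * j + 4)) =
      treeStep _ (T (2 * j + 3)) (T (2 * j + 4))
    rw [h2c, p3, h2d _ (by omega)]
    rfl
  obtain ⟨l₁, hl₁, mem₁⟩ := hG T₁ T hT1 h1a hP (fun c hc => (h1b c hc).symm)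
  obtain ⟨l₂, hl₂, mem₂⟩ := hM T₂ T' hT2 h2a h2b (fun c hc => hL c (by omega))
    (fun c hc => by
      rcases eq_or_ne c (2 * j + 2) with rfl | hne
      · rw [h2e, hL _ (by omega), lastCode_add_two_spoke hj]
      · rcases eq_or_ne c (2 * j + 3) with rfl | hne'
        · rw [h2c, hL _ (by omega)]; exact lastCode_pred (by omega)
        · rw [hA c (by omega), h2d c (by omega)])
  have q3 : T₁ (2 * j + 3) = false := (h1b _ (by omega)).trans p3
  have key : ∀ x, CodesTree n x → AgreeAbove (2 * j + 3) x T →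
      x (2 * j + 3) = false → x ∈ l₁ := by
    intro x hx hxT h3
    refine (mem₁ x).2 ⟨hx, fun c hc => ?_⟩
    rcases eq_or_ne c (2 * j + 3) with rfl | hne
    · rw [h3, q3]
    · rw [hxT c (by omega), h1b c (by omega)]
  have key2 : ∀ x, CodesTree n x → AgreeAbove (2 * j + 3) x T →
      x (2 * j + 3) = true → x ∈ l₂ := by
    intro x hx hxT h3
    refine (mem₂ x).2 ⟨hx, fun c hc => ?_⟩
    rcases eq_or_ne c (2 * j + 2) with rfl | hne
    · rw [h2e]
      by_contra hne
      exact hx.not_spoke_and_path hT (by omega) hjn hTs p3 hxT (by simpa using hne) h3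
    · rcases eq_or_ne c (2 * j + 3) with rfl | hne'
      · rw [h3, h2c]
      · rw [hxT c (by omega), h2d c (by omega)]
  have mv : IsCodeMove T₁ T₂ (j + 1) 0 1 := by
    refine ⟨?_, h2b, q3, h2c, fun c hc hc' => ?_⟩
    · exact (h1a (2 * j + 1) (by omega)).trans (pathCode_odd hj)
    · simp only [dirCode] at hc hc'
      by_cases h : c ≤ 2 * j
      · rw [h2a c h, h1a c (by omega)]
      · by_cases h' : c = 2 * j + 2
        · rw [h', h2e, h1a _ (by omega)]; exact (pathCode_even (i := j + 1) (by omega)).symm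
        · rw [h2d c (by omega), h1b c (by omega)]
  refine ⟨l₁.reverse ++ l₂, ?_, fun x => ?_⟩
  · obtain ⟨k, rfl⟩ : ∃ k, j = k + 2 := ⟨j - 2, by omega⟩
    rw [genMoves_false]
    refine TwoWayListing.join (hl₁.rev.mono (by simp) ?_) (hl₂.mono (by simp) subset_rfl)
      (by omega) (by omega) mv ?_ ?_ ?_
    -- After reversal the exceptional trees must come later. They contain `v_{j+1}v_{j+2}`, so they
    -- are in the second half.
    · rintro x ⟨-, hx, h3, hxT⟩
      exact Or.inr (key2 x hx (fun c hc => by rw [hxT c hc, h1b c (by omega)]) h3)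
    · intro x hx hx'
      have := ((mem₁ x).1 (List.mem_reverse.1 hx)).2 (2 * (k + 2) + 3) (by omega)
      rw [((mem₂ x).1 hx').2 _ (by omega), h2c, q3] at this
      cases this
    · intro i e e' x hlt hmv hx
      rcases hlt with h | ⟨rfl, h⟩
      · have ha := hmv.agreeAbove (m := 2 * (k + 2) + 1) (by omega)
        refine Or.inr (List.mem_reverse.2 (key x hx (fun c hc => ?_) ?_))
        · rw [ha c (by omega), h1b c (by omega)]
        · rw [ha _ (by omega), q3]
      · exact absurd hmv.ne ((by decide : ∀ e e' : Fin 3, e < 0 ∨ e = 0 ∧ e' < 1 → ¬ e ≠ e') e e' h)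
    · intro i e e' x hlt hmv hx
      rcases hlt with h | ⟨rfl, h⟩
      · exact Or.inr ((mem₂ x).2 ⟨hx, hmv.agreeAbove (by omega)⟩)
      · obtain rfl := (by decide : ∀ e e' : Fin 3, e < 1 ∨ e = 1 ∧ e' < 0 → e = 0) e e' h
        exact absurd (hmv.old_left.symm.trans h2b) (by simp)
  · rw [List.mem_append, List.mem_reverse]
    constructor
    · rintro (h | h)
      · refine ⟨((mem₁ x).1 h).1, fun c hc => ?_⟩
        rw [((mem₁ x).1 h).2 c (by omega), h1b c (by omega)]
      · refine ⟨((mem₂ x).1 h).1, fun c hc => ?_⟩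
        rw [((mem₂ x).1 h).2 c (by omega), h2d c (by omega)]
    · rintro ⟨hx, hxT⟩
      cases h0 : x (2 * j + 3)
      · exact Or.inl (key x hx hxT h0)
      · exact Or.inr (key2 x hx hxT h0)

/-- The split is by the spoke at `v_{m+1}`. The half with the spoke is an upper listing read
backwards, so it ends at that listing's start, which carries `L_m`: this is how `L_{m+3}` comes to
contain `L_m`. -/
theorem innerListing_succ {n m : ℕ} (hm : 2 ≤ m) (hmn : m + 1 < n) (hG : LinkedListing n (m + 1))
    (hH : UpperListing n m) : InnerListing n (m + 1) := by
  intro T T' hT hP hp hL hA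
  have p3 : T (2 * m + 3) = false := hp
  have hTs : treeState T (m + 1) = some true := treeState_pathCode (by omega) hP
  have hlast : lastCode (m + 1 + 2) = fun c => if c ≤ 2 * m then lastCode m c else
      decide (c = 2 * m + 2 ∨ c = 2 * m + 5 ∨ c = 2 * m + 6) := by
    obtain ⟨k, rfl⟩ : ∃ k, m = k + 2 := ⟨m - 2, by omega⟩
    funext c
    rw [lastCode]
    rfl
  have r0 : AgreeUpTo (2 * m) T' (lastCode m) := fun c hc => by
    rw [hL c (by omega), hlast]; simp [hc]
  have r1 : T' (2 * m + 1) = false := by rw [hL _ (by omega), hlast]; simp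
  have r2 : T' (2 * m + 2) = true := by rw [hL _ (by omega), hlast]; simp
  have r3 : T' (2 * m + 3) = false := by rw [hL _ (by omega), hlast]; simp
  obtain ⟨T₁, h1a, h1b, h1c, h1d⟩ : ∃ T₁, (∀ c < 2 * m + 2, T₁ c = lastCode (m + 1) c) ∧
      T₁ (2 * m + 2) = false ∧ T₁ (2 * m + 3) = true ∧ AgreeAbove (2 * m + 3) T₁ T :=
    ⟨fun c => if c < 2 * m + 2 then lastCode (m + 1) c else if c = 2 * m + 2 then false else
      if c = 2 * m + 3 then true else T c, fun c hc => if_pos hc, by simp, by simp,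
      fun c hc => by simp (disch := omega) only [if_neg]⟩
  obtain ⟨T₂, h2a, h2b, h2d⟩ : ∃ T₂, AgreeUpTo (2 * m + 2) T₂ (lastCode (m + 1)) ∧
      T₂ (2 * m + 3) = false ∧ AgreeAbove (2 * m + 3) T₂ T :=
    ⟨fun c => if c ≤ 2 * m + 2 then lastCode (m + 1) c else if c = 2 * m + 3 then false else T c,
      fun c hc => if_pos hc, by simp, fun c hc => by simp (disch := omega) only [if_neg]⟩
  have h2c : T₂ (2 * m + 2) = true := (h2a _ le_rfl).trans (lastCode_top (by omega))
  have hT' : CodesTree n T' := by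
    refine hT.of_treeState_eq (k := m + 1) (by omega) (by omega) (fun c hc => ?_)
      (fun c hc => by rw [r0 c (by omega), lastCode_low m c hc]) ?_
    · rcases eq_or_ne c (2 * m + 3) with rfl | hne
      · rw [r3, p3]
      · exact hA c (by omega)
    · rw [hTs, treeState_succ _ (by omega), treeState_lastCode hm r0, r1, r2]
      rfl
  obtain ⟨l₁, hl₁, mem₁⟩ := hG T T₁ hT hP hp h1a h1b h1c h1d
  obtain ⟨l₂, hl₂, mem₂⟩ := hH false T' T₂ hT' r0 r1 (fun c hc => h2a c (by omega))
    (fun c hc => by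
      rcases eq_or_ne c (2 * m + 2) with rfl | hne
      · rw [r2, h2c]
      · rcases eq_or_ne c (2 * m + 3) with rfl | hne'
        · rw [r3, h2b]
        · rw [hA c (by omega), h2d c (by omega)])
  have key : ∀ x, CodesTree n x → AgreeAbove (2 * m + 3) x T →
      x (2 * m + 2) = false → x ∈ l₁ := fun x hx hxT h2 => (mem₁ x).2 ⟨hx, h2, hxT⟩
  have bad : ∀ x, CodesTree n x → AgreeAbove (2 * m + 3) x T →
      x (2 * m + 2) = true → x (2 * m + 3) = true → False := fun x hx hxT =>
    hx.not_spoke_and_path hT (by omega) hmn hTs p3 hxT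
  have key2 : ∀ x, CodesTree n x → AgreeAbove (2 * m + 3) x T →
      x (2 * m + 2) = true → x ∈ l₂ := by
    intro x hx hxT h2
    refine (mem₂ x).2 ⟨hx, fun c hc => ?_⟩
    rcases eq_or_ne c (2 * m + 2) with rfl | hne
    · rw [h2, r2]
    · rcases eq_or_ne c (2 * m + 3) with rfl | hne'
      · rw [r3]
        by_contra hne
        exact bad x hx hxT h2 (by simpa using hne)
      · rw [hxT c (by omega), hA c (by omega)]
  have mv : IsCodeMove T₁ T₂ (m + 1) 1 2 := by
    refine ⟨h1c, h2b, h1b, h2c, fun c hc hc' => ?_⟩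
    simp only [dirCode] at hc hc'
    by_cases h : c ≤ 2 * m + 1
    · rw [h2a c (by omega), h1a c (by omega)]
    · rw [h2d c (by omega), h1d c (by omega)]
  refine ⟨l₁ ++ l₂.reverse, ?_, fun x => ?_⟩
  · rw [if_pos (by omega), List.append_assoc, List.singleton_append]
    refine TwoWayListing.join (d := 1) (d' := 2) (hl₁.mono (by simp) (by simp))
      (hl₂.rev.mono (by simp) (by simp)) (by omega) (by omega) mv ?_ ?_ ?_
    · intro x hx hx'
      have := ((mem₁ x).1 hx).2.1
      change x (2 * m + 2) = _ at this
      rw [((mem₂ x).1 (List.mem_reverse.1 hx')).2 _ (by omega), r2] at this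
      cases this
    · intro i e e' x hlt hmv hx
      rcases hlt with h | ⟨rfl, h⟩
      · have ha := hmv.agreeAbove (m := 2 * m + 1) (by omega)
        refine Or.inr (key x hx (fun c hc => ?_) ?_)
        · rw [ha c (by omega), h1d c (by omega)]
        · rw [ha _ (by omega), h1b]
      · have hxT : AgreeAbove (2 * m + 3) x T := fun c hc => by
          rw [hmv.agreeAbove (m := 2 * m + 3) (by omega) c hc, h1d c hc]
        rcases (by decide : ∀ e e' : Fin 3, e < 1 ∨ e = 1 ∧ e' < 2 → e ≠ e' →
            e = 0 ∧ e' = 1 ∨ e = 0 ∧ e' = 2 ∨ e = 1 ∧ e' = 0) e e' h hmv.ne with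
            ⟨rfl, rfl⟩ | ⟨rfl, rfl⟩ | ⟨rfl, rfl⟩
        · exact absurd (hmv.new_left.symm.trans h1c) (by simp)
        · refine (bad x hx hxT hmv.new_right ?_).elim
          rw [hmv.same _ (by simp only [dirCode]; omega) (by simp only [dirCode]; omega), h1c]
        · refine Or.inr (key x hx hxT ?_)
          rw [hmv.same _ (by simp only [dirCode]; omega) (by simp only [dirCode]; omega), h1b]
    · intro i e e' x hlt hmv hx
      rcases hlt with h | ⟨rfl, h⟩
      · have ha := hmv.agreeAbove (m := 2 * m + 1) (by omega)
        refine Or.inr (List.mem_reverse.2 (key2 x hx (fun c hc => ?_) ?_))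
        · rw [ha c (by omega), h2d c (by omega)]
        · rw [ha _ (by omega), h2c]
      · have hxT : AgreeAbove (2 * m + 3) x T := fun c hc => by
          rw [hmv.agreeAbove (m := 2 * m + 3) (by omega) c hc, h2d c hc]
        rcases (by decide : ∀ e e' : Fin 3, e < 2 ∨ e = 2 ∧ e' < 1 → e ≠ e' →
            e = 0 ∧ e' = 1 ∨ e = 0 ∧ e' = 2 ∨ e = 1 ∨ e = 2 ∧ e' = 0) e e' h hmv.ne with
            ⟨rfl, rfl⟩ | ⟨rfl, rfl⟩ | rfl | ⟨rfl, rfl⟩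
        · refine (bad x hx hxT ?_ hmv.new_right).elim
          rw [hmv.same _ (by simp only [dirCode]; omega) (by simp only [dirCode]; omega), h2c]
        · exact absurd (hmv.new_left.symm.trans h2c) (by simp)
        · exact absurd (hmv.old_left.symm.trans h2b) (by simp)
        -- Exchanging the spoke for `v_mv_{m+1}` is impossible, as `L_{m+1}` already contains that
        -- edge.
        · have : T₂ (2 * m + 1) = true := (h2a _ (by omega)).trans (lastCode_pred hm)
          exact absurd (hmv.new_left.symm.trans this) (by simp)
  · rw [List.mem_append, List.mem_reverse]
    constructor
    · rintro (h | h)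
      · exact ⟨((mem₁ x).1 h).1, ((mem₁ x).1 h).2.2⟩
      · refine ⟨((mem₂ x).1 h).1, fun c hc => ?_⟩
        rw [((mem₂ x).1 h).2 c (by omega), hA c (by omega)]
    · rintro ⟨hx, hxT⟩
      cases h0 : x (2 * m + 2)
      · exact Or.inl (key x hx hxT h0)
      · exact Or.inr (key2 x hx hxT h0)

/-! ### Base cases and the simultaneous induction. -/

/-- The two trees that differ by exchanging the edges `v_2v_∞` and `v_2v_3`. -/
theorem exists_twoWayListing_pair {n : ℕ} (hn : 3 ≤ n) {T T' : ℕ → Bool} (hT : CodesTree n T)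
    (h4 : T 4 = true) (h5 : T 5 = false) (low : ∀ c < 4, T' c = false) (h4' : T' 4 = false)
    (h5' : T' 5 = true) (hA : AgreeAbove 5 T' T) :
    ∃ l, TwoWayListing n T T' l [(fanVertex n 2, ⊤, fanVertex n 3)] ∅ ∅ ∧
      ∀ x, x ∈ l ↔ CodesTree n x ∧ AgreeAbove 5 x T := by
  have st : ∀ x : ℕ → Bool, x 3 = false →
      treeState x 3 = treeStep (some (x 4)) (x 5) (x 6) := fun x h => by
    simp [treeState, h, treeStep]
  have hT' : CodesTree n T' := by
    refine hT.of_treeState_eq (k := 3) (by omega) hn (fun c hc => hA c (by omega)) low ?_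
    rw [st T (hT.low 3 (by omega)), st T' (low 3 (by omega)), h4, h5, h4', h5', hA 6 (by omega)]
    rfl
  have key : ∀ x, CodesTree n x → AgreeAbove 5 x T → x = T ∨ x = T' := by
    intro x hx hxT
    have e := hx.treeState_eq hT (k := 3) (by omega) hn fun c hc => hxT c (by omega)
    rw [st T (hT.low 3 (by omega)), st x (hx.low 3 (by omega)), h4, h5, hxT 6 (by omega)] at e
    -- The state at `v_3` is that of `T`, which forces exactly one of `v_2v_∞` and `v_2v_3`.
    have : x 4 = true ∧ x 5 = false ∨ x 4 = false ∧ x 5 = true := by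
      revert e
      cases x 4 <;> cases x 5 <;> cases T 6 <;> simp [treeStep]
    rcases this with ⟨a, b⟩ | ⟨a, b⟩
    · left
      funext c
      by_cases h : c < 4
      · rw [hx.low c h, hT.low c h]
      · by_cases h' : 5 < c
        · exact hxT c h'
        · obtain rfl | rfl : c = 4 ∨ c = 5 := by omega
          exacts [a.trans h4.symm, b.trans h5.symm]
    · right
      funext c
      by_cases h : c < 4
      · rw [hx.low c h, low c h]
      · by_cases h' : 5 < c
        · rw [hxT c h', hA c h']
        · obtain rfl | rfl : c = 4 ∨ c = 5 := by omega
          exacts [a.trans h4'.symm, b.trans h5'.symm]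
  -- Direction `0` at `v_2` has code 3, which belongs to no edge.
  have nolow : ∀ y i e x, IsCodeMove y x i e 0 → i ≤ 2 → CodesTree n x → False := by
    intro y i e x hm hi hx
    have := hm.new_right
    rw [hx.low _ (by simp only [dirCode]; omega)] at this
    cases this
  have nosmall : ∀ y i e e' x, (∀ c < 4, y c = false) → IsCodeMove y x i e e' → i < 2 → False := by
    intro y i e e' x hy hm hi
    have := hm.old_left
    rw [hy _ (by fin_cases e <;> simp only [dirCode] <;> omega)] at this
    cases this
  refine ⟨[T] ++ [T'], ?_, fun x => ?_⟩
  · refine TwoWayListing.join (i := 2) (d := 2) (d' := 1) (TwoWayListing.single hT)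
      (TwoWayListing.single hT') le_rfl (by omega) ?_ ?_ ?_ ?_
    · refine ⟨h4, h4', h5, h5', fun c hc hc' => ?_⟩
      simp only [dirCode] at hc hc'
      by_cases h : c < 4
      · rw [hT.low c h, low c h]
      · exact hA c (by omega)
    · intro x hx hx'
      obtain rfl := List.mem_singleton.1 hx
      obtain rfl := List.mem_singleton.1 hx'
      exact absurd (h4.symm.trans h4') (by simp)
    · intro j e e' x hlt hmv hx
      rcases hlt with h | ⟨rfl, h⟩
      · exact (nosmall T j e e' x hT.low hmv h).elim
      · rcases (by decide : ∀ e e' : Fin 3, e < 2 ∨ e = 2 ∧ e' < 1 → e ≠ e' →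
            e = 0 ∨ e = 1 ∨ e' = 0) e e' h hmv.ne with rfl | rfl | rfl
        · exact absurd (hmv.old_left.symm.trans (hT.low 3 (by omega))) (by simp)
        · exact absurd (hmv.old_left.symm.trans h5) (by simp)
        · exact (nolow T 2 e x hmv le_rfl hx).elim
    · intro j e e' x hlt hmv hx
      rcases hlt with h | ⟨rfl, h⟩
      · exact (nosmall T' j e e' x low hmv h).elim
      · rcases (by decide : ∀ e e' : Fin 3, e < 1 ∨ e = 1 ∧ e' < 2 → e ≠ e' →
            e = 0 ∨ e' = 0) e e' h hmv.ne with rfl | rfl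
        · exact absurd (hmv.old_left.symm.trans (low 3 (by omega))) (by simp)
        · exact (nolow T' 2 e x hmv le_rfl hx).elim
  · simp only [List.cons_append, List.nil_append, List.mem_cons, List.not_mem_nil, or_false]
    constructor
    · rintro (rfl | rfl)
      exacts [⟨hT, fun _ _ => rfl⟩, ⟨hT', hA⟩]
    · rintro ⟨hx, hxT⟩
      exact key x hx hxT

theorem upperListing_two {n : ℕ} (hn : 3 ≤ n) : UpperListing n 2 := by
  intro e T T' hT hP hp hL hA
  have h4 : T 4 = true := hP 4 (by omega)
  obtain ⟨l, hl, mem⟩ := exists_twoWayListing_pair hn hT h4 hp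
    (fun c hc => (hL c (by omega)).trans (lastCode_low 3 c hc)) (hL 4 (by omega))
    (hL 5 (by omega)) hA
  refine ⟨l, ?_, mem⟩
  simpa [genMoves] using hl

/-- The same single move serves here as in `upperListing_two`, since `L_3` and `L_4` have equal
codes up to 5. -/
theorem innerListing_two {n : ℕ} (hn : 3 ≤ n) : InnerListing n 2 := by
  intro T T' hT hP hp hL hA
  have h4 : T 4 = true := hP 4 (by omega)
  obtain ⟨l, hl, mem⟩ := exists_twoWayListing_pair hn hT h4 hp
    (fun c hc => (hL c (by omega)).trans (lastCode_low 4 c hc)) (hL 4 (by omega))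
    (hL 5 (by omega)) hA
  refine ⟨l, ?_, mem⟩
  simpa [genMoves, revMoves] using hl

/-- `LinkedListing` is built from the previous stage and consumed at once, so it is not carried
along. The upper and inner families involve `v_kv_{k+1}` and need `k < n`. -/
theorem listings (n k : ℕ) (hk : 2 ≤ k) (hkn : k ≤ n) :
    OpenListing n k ∧ (k < n → UpperListing n k ∧ InnerListing n k) := by
  induction k, hk using Nat.le_induction with
  | base => exact ⟨openListing_two hkn, fun h => ⟨upperListing_two h, innerListing_two h⟩⟩
  | succ k hk ih =>
    obtain ⟨hO, hUI⟩ := ih (by omega)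
    obtain ⟨hU, hI⟩ := hUI (by omega)
    have hO' := openListing_succ hk (by omega) hO hU
    exact ⟨hO', fun h => ⟨upperListing_succ hk h hO' hI,
      innerListing_succ hk h (linkedListing_succ hk h hO hU) hU⟩⟩

/-! ## From codes to subgraphs of the fan -/

theorem fanVertex_ne_top {n i : ℕ} (h : 2 ≤ i) (h' : i ≤ n) : fanVertex n i ≠ ⊤ := by
  rw [fanVertex, dif_pos ⟨h, h'⟩]
  exact WithTop.coe_ne_top

theorem fanVertex_lt {n i j : ℕ} (hi : 2 ≤ i) (hij : i < j) (hj : j ≤ n) :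
    fanVertex n i < fanVertex n j := by
  rw [fanVertex, dif_pos ⟨hi, by omega⟩, fanVertex, dif_pos ⟨by omega, hj⟩, WithTop.coe_lt_coe]
  exact hij

theorem fanVertex_inj {n i j : ℕ} (hi : 2 ≤ i) (hi' : i ≤ n) (hj : 2 ≤ j) (hj' : j ≤ n) :
    fanVertex n i = fanVertex n j ↔ i = j := by
  refine ⟨fun h => ?_, fun h => h ▸ rfl⟩
  rcases lt_trichotomy i j with h' | h' | h'
  · exact absurd h (fanVertex_lt hi h' hj').ne
  · exact h'
  · exact absurd h.symm (fanVertex_lt hj h' hi').ne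

theorem eq_top_or_eq_fanVertex {n : ℕ} (v : FanVertex n) :
    v = ⊤ ∨ ∃ i, 2 ≤ i ∧ i ≤ n ∧ v = fanVertex n i := by
  rcases v with _ | ⟨i, hi⟩
  · exact Or.inl rfl
  · refine Or.inr ⟨i, hi.1, hi.2, ?_⟩
    rw [fanVertex, dif_pos hi]
    rfl

/-- The edge of the fan with a given code. -/
def codeEdge (n c : ℕ) : Sym2 (FanVertex n) :=
  if c % 2 = 0 then s(⊤, fanVertex n (c / 2)) else s(fanVertex n (c / 2), fanVertex n (c / 2 + 1))

theorem codeEdge_even (n i : ℕ) : codeEdge n (2 * i) = s(⊤, fanVertex n i) := by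
  rw [codeEdge, if_pos (by omega), Nat.mul_div_cancel_left i (by omega)]

theorem codeEdge_odd (n i : ℕ) :
    codeEdge n (2 * i + 1) = s(fanVertex n i, fanVertex n (i + 1)) := by
  rw [codeEdge, if_neg (by omega), show (2 * i + 1) / 2 = i by omega]

theorem even_or_odd_code {n c : ℕ} (h : 4 ≤ c) (h' : c ≤ 2 * n) :
    ∃ i, 2 ≤ i ∧ i ≤ n ∧ (c = 2 * i ∨ (c = 2 * i + 1 ∧ i + 1 ≤ n)) :=
  ⟨c / 2, by omega, by omega, by omega⟩

theorem codeEdge_inj {n c c' : ℕ} (h : 4 ≤ c) (h' : c ≤ 2 * n) (k : 4 ≤ c') (k' : c' ≤ 2 * n)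
    (e : codeEdge n c = codeEdge n c') : c = c' := by
  obtain ⟨i, hi, hin, rfl | ⟨rfl, hi'⟩⟩ := even_or_odd_code h h' <;>
  obtain ⟨j, hj, hjn, rfl | ⟨rfl, hj'⟩⟩ := even_or_odd_code k k' <;>
  simp only [codeEdge_even, codeEdge_odd, Sym2.eq_iff] at e
  · rcases e with ⟨-, e⟩ | ⟨e, -⟩
    · rw [(fanVertex_inj hi hin hj hjn).1 e]
    · exact absurd e.symm (fanVertex_ne_top hj hjn)
  · rcases e with ⟨e, -⟩ | ⟨e, -⟩
    · exact absurd e.symm (fanVertex_ne_top hj hjn)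
    · exact absurd e.symm (fanVertex_ne_top (by omega) hj')
  · rcases e with ⟨e, -⟩ | ⟨-, e⟩
    · exact absurd e (fanVertex_ne_top hi hin)
    · exact absurd e (fanVertex_ne_top (by omega) hi')
  · rcases e with ⟨e, -⟩ | ⟨e, e'⟩
    · rw [(fanVertex_inj hi hin hj hjn).1 e]
    · have := (fanVertex_inj hi hin (by omega) hj').1 e
      have := (fanVertex_inj (by omega) hi' hj hjn).1 e'
      omega

theorem codeEdge_not_isDiag {n c : ℕ} (h : 4 ≤ c) (h' : c ≤ 2 * n) : ¬ (codeEdge n c).IsDiag := by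
  obtain ⟨i, hi, hin, rfl | ⟨rfl, hi'⟩⟩ := even_or_odd_code h h'
  · rw [codeEdge_even, Sym2.mk_isDiag_iff]
    exact (fanVertex_ne_top hi hin).symm
  · rw [codeEdge_odd, Sym2.mk_isDiag_iff]
    exact (fanVertex_lt hi (by omega) hi').ne

/-- The subgraph of the fan with a given code. -/
def codeGraph (n : ℕ) (x : ℕ → Bool) : SimpleGraph (FanVertex n) :=
  SimpleGraph.fromEdgeSet {e | ∃ c, 4 ≤ c ∧ c ≤ 2 * n ∧ x c = true ∧ e = codeEdge n c}

theorem mem_edgeSet_codeGraph {n : ℕ} {x : ℕ → Bool} {e : Sym2 (FanVertex n)} :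
    e ∈ (codeGraph n x).edgeSet ↔ ∃ c, 4 ≤ c ∧ c ≤ 2 * n ∧ x c = true ∧ e = codeEdge n c := by
  rw [codeGraph, SimpleGraph.edgeSet_fromEdgeSet]
  refine ⟨fun h => h.1, fun h => ⟨h, ?_⟩⟩
  obtain ⟨c, h1, h2, -, rfl⟩ := h
  exact codeEdge_not_isDiag h1 h2

theorem codeGraph_adj {n : ℕ} {x : ℕ → Bool} {a b : FanVertex n} :
    (codeGraph n x).Adj a b ↔
      ∃ c, 4 ≤ c ∧ c ≤ 2 * n ∧ x c = true ∧ s(a, b) = codeEdge n c := by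
  rw [← SimpleGraph.mem_edgeSet, mem_edgeSet_codeGraph]

theorem codeEdge_mem {n c : ℕ} {x : ℕ → Bool} (h : 4 ≤ c) (h' : c ≤ 2 * n) :
    codeEdge n c ∈ (codeGraph n x).edgeSet ↔ x c = true := by
  rw [mem_edgeSet_codeGraph]
  refine ⟨fun ⟨c', h1, h2, h3, h4⟩ => ?_, fun hx => ⟨c, h, h', hx, rfl⟩⟩
  rwa [codeEdge_inj h h' h1 h2 h4]

theorem CodesTree.code_mem {n c : ℕ} {x : ℕ → Bool} (hx : CodesTree n x) (h : x c = true) :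
    4 ≤ c ∧ c ≤ 2 * n := by
  constructor <;> by_contra hc
  · simp [hx.low c (by omega)] at h
  · simp [hx.high c (by omega)] at h

theorem CodesTree.ext_codeGraph {n : ℕ} {x y : ℕ → Bool} (hx : CodesTree n x)
    (hy : CodesTree n y) (h : codeGraph n x = codeGraph n y) : x = y := by
  funext c
  by_cases h1 : c < 4
  · rw [hx.low c h1, hy.low c h1]
  · by_cases h2 : 2 * n < c
    · rw [hx.high c h2, hy.high c h2]
    · rw [Bool.eq_iff_iff, ← codeEdge_mem (n := n) (by omega) (by omega), h,
        codeEdge_mem (by omega) (by omega)]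

theorem fan_eq (n : ℕ) : fan n = codeGraph n fun _ => true := by
  ext a b
  rw [fan, SimpleGraph.fromRel_adj, codeGraph_adj]
  constructor
  · have key : ∀ a b : FanVertex n, a ≠ b → (a = ⊤ ∨ ∃ i, 2 ≤ i ∧ i + 1 ≤ n ∧
        a = fanVertex n i ∧ b = fanVertex n (i + 1)) →
        ∃ c, 4 ≤ c ∧ c ≤ 2 * n ∧ true = true ∧ s(a, b) = codeEdge n c := by
      rintro a b hab (rfl | ⟨i, hi, hin, rfl, rfl⟩)
      · rcases eq_top_or_eq_fanVertex b with rfl | ⟨i, hi, hin, rfl⟩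
        · exact absurd rfl hab
        · exact ⟨2 * i, by omega, by omega, rfl, (codeEdge_even n i).symm⟩
      · exact ⟨2 * i + 1, by omega, by omega, rfl, (codeEdge_odd n i).symm⟩
    rintro ⟨hab, h | h⟩
    · exact key a b hab h
    · rw [Sym2.eq_swap]
      exact key b a hab.symm h
  · rintro ⟨c, h, h', -, e⟩
    refine ⟨fun hab => codeEdge_not_isDiag h h' (e ▸ Sym2.mk_isDiag_iff.2 hab), ?_⟩
    obtain ⟨i, hi, hin, rfl | ⟨rfl, hi'⟩⟩ := even_or_odd_code h h'
    · rw [codeEdge_even, Sym2.eq_iff] at e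
      rcases e with ⟨e, -⟩ | ⟨-, e⟩
      exacts [Or.inl (Or.inl e), Or.inr (Or.inl e)]
    · rw [codeEdge_odd, Sym2.eq_iff] at e
      rcases e with ⟨e, e'⟩ | ⟨e, e'⟩
      exacts [Or.inl (Or.inr ⟨i, hi, hi', e, e'⟩), Or.inr (Or.inr ⟨i, hi, hi', e', e⟩)]

/-- The code of `P_n` without the irrelevant entries. -/
def fanPathCode (n c : ℕ) : Bool := if c ≤ 2 * n then pathCode c else false

theorem fanPath_eq {n : ℕ} (hn : 2 ≤ n) : fanPath n = codeGraph n (fanPathCode n) := by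
  ext a b
  rw [fanPath, SimpleGraph.fromRel_adj, codeGraph_adj]
  constructor
  · have key : ∀ a b : FanVertex n, (a = ⊤ ∧ b = fanVertex n 2 ∨ ∃ i, 2 ≤ i ∧ i + 1 ≤ n ∧
        a = fanVertex n i ∧ b = fanVertex n (i + 1)) →
        ∃ c, 4 ≤ c ∧ c ≤ 2 * n ∧ fanPathCode n c = true ∧ s(a, b) = codeEdge n c := by
      rintro a b (⟨rfl, rfl⟩ | ⟨i, hi, hin, rfl, rfl⟩)
      · refine ⟨2 * 2, by omega, by omega, ?_, (codeEdge_even n 2).symm⟩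
        rw [fanPathCode, if_pos (by omega)]
        rfl
      · refine ⟨2 * i + 1, by omega, by omega, ?_, (codeEdge_odd n i).symm⟩
        rw [fanPathCode, if_pos (by omega), pathCode_odd hi]
    rintro ⟨-, h | h⟩
    · exact key a b h
    · rw [Sym2.eq_swap]
      exact key b a h
  · rintro ⟨c, h, h', hc, e⟩
    refine ⟨fun hab => codeEdge_not_isDiag h h' (e ▸ Sym2.mk_isDiag_iff.2 hab), ?_⟩
    rw [fanPathCode, if_pos h'] at hc
    obtain ⟨i, hi, hin, rfl | ⟨rfl, hi'⟩⟩ := even_or_odd_code h h'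
    · obtain rfl : i = 2 := by
        by_contra hne
        simp [pathCode_even (i := i) (by omega)] at hc
      rw [codeEdge_even, Sym2.eq_iff] at e
      rcases e with ⟨e, e'⟩ | ⟨e, e'⟩
      exacts [Or.inl (Or.inl ⟨e, e'⟩), Or.inr (Or.inl ⟨e', e⟩)]
    · rw [codeEdge_odd, Sym2.eq_iff] at e
      rcases e with ⟨e, e'⟩ | ⟨e, e'⟩
      exacts [Or.inl (Or.inr ⟨i, hi, hi', e, e'⟩), Or.inr (Or.inr ⟨i, hi, hi', e', e⟩)]

theorem codeGraph_le_fan (n : ℕ) (x : ℕ → Bool) : codeGraph n x ≤ fan n := by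
  rw [fan_eq]
  intro a b h
  rw [codeGraph_adj] at h ⊢
  obtain ⟨c, h1, h2, -, h3⟩ := h
  exact ⟨c, h1, h2, rfl, h3⟩

theorem exists_codeGraph_eq {n : ℕ} {T : SimpleGraph (FanVertex n)} (hT : T ≤ fan n) :
    ∃ x, (∀ c < 4, x c = false) ∧ (∀ c, 2 * n < c → x c = false) ∧ codeGraph n x = T := by
  classical
  refine ⟨fun c => decide (4 ≤ c ∧ c ≤ 2 * n ∧ codeEdge n c ∈ T.edgeSet), fun c hc => ?_,
    fun c hc => ?_, ?_⟩
  · simp; omega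
  · simp; omega
  · ext a b
    rw [codeGraph_adj]
    constructor
    · rintro ⟨c, h1, h2, h3, h4⟩
      rw [← SimpleGraph.mem_edgeSet, h4]
      exact (of_decide_eq_true h3).2.2
    · intro h
      have h' := hT h
      rw [fan_eq, codeGraph_adj] at h'
      obtain ⟨c, h1, h2, -, h3⟩ := h'
      exact ⟨c, h1, h2, decide_eq_true ⟨h1, h2, h3 ▸ h⟩, h3⟩

/-! ## Spanning trees are the codes accepted by the automaton -/

/-- The graph `H` is arbitrary so that the lemma also applies after a later spoke has been deleted,
as needed to detect a cycle. -/
theorem reachable_of_treeState {n : ℕ} {x : ℕ → Bool} (hlow : ∀ c < 4, x c = false)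
    {H : SimpleGraph (FanVertex n)} {i : ℕ} (hi : 1 ≤ i)
    (hH : ∀ c, 4 ≤ c → c ≤ 2 * i → x c = true → codeEdge n c ∈ H.edgeSet) {b : Bool}
    (hb : treeState x i = some b) :
    ∀ j, 2 ≤ j → j ≤ i → H.Reachable (fanVertex n j) ⊤ ∨
      b = false ∧ H.Reachable (fanVertex n j) (fanVertex n i) := by
  induction i, hi using Nat.le_induction generalizing b with
  | base => intro j h1 h2; omega
  | succ i hi ih =>
    have hp : x (2 * i + 1) = true → 2 ≤ i ∧ H.Adj (fanVertex n i) (fanVertex n (i + 1)) := by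
      intro h
      have h2 : 2 ≤ i := by
        by_contra hc
        rw [hlow _ (by omega)] at h
        cases h
      refine ⟨h2, ?_⟩
      rw [← SimpleGraph.mem_edgeSet, ← codeEdge_odd]
      exact hH _ (by omega) (by omega) h
    have hs : x (2 * i + 2) = true → H.Adj (fanVertex n (i + 1)) ⊤ := by
      intro h
      rw [H.adj_comm, ← SimpleGraph.mem_edgeSet, ← codeEdge_even]
      exact hH _ (by omega) (by omega) h
    rw [treeState_succ x hi] at hb
    intro j hj hji
    rcases ha : treeState x i with _ | _ | _
    · simp [ha, treeStep] at hb
    · have hi' := ih (fun c h1 h2 => hH c h1 (by omega)) ha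
      rw [ha] at hb
      cases hp' : x (2 * i + 1)
      · simp [hp', treeStep] at hb
      · obtain ⟨h2, hadj⟩ := hp hp'
        have hr : H.Reachable (fanVertex n j) ⊤ ∨
            H.Reachable (fanVertex n j) (fanVertex n (i + 1)) := by
          rcases Nat.lt_or_ge i j with h | h
          · obtain rfl : j = i + 1 := by omega
            exact Or.inr (SimpleGraph.Reachable.refl _)
          · rcases hi' j hj h with h | ⟨-, h⟩
            exacts [Or.inl h, Or.inr (h.trans hadj.reachable)]
        cases hs' : x (2 * i + 2)
        · simp only [hp', hs', treeStep, Option.some.injEq] at hb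
          exact hr.imp id fun h => ⟨hb.symm, h⟩
        · exact Or.inl (hr.elim id fun h => h.trans (hs hs').reachable)
    · have hi' := ih (fun c h1 h2 => hH c h1 (by omega)) ha
      rw [ha] at hb
      rcases Nat.lt_or_ge i j with h | h
      · obtain rfl : j = i + 1 := by omega
        cases hs' : x (2 * i + 2)
        · cases hp' : x (2 * i + 1)
          · simp only [hp', hs', treeStep, Option.some.injEq] at hb
            exact Or.inr ⟨hb.symm, SimpleGraph.Reachable.refl _⟩
          · obtain ⟨h2, hadj⟩ := hp hp'
            rcases hi' i h2 le_rfl with h | ⟨h, -⟩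
            · exact Or.inl (hadj.symm.reachable.trans h)
            · cases h
        · exact Or.inl (hs hs').reachable
      · rcases hi' j hj h with h | ⟨h, -⟩
        · exact Or.inl h
        · cases h

/-- Edge count of a tree on the `i` vertices `v_2, …, v_i, v_∞`; in the pending state one edge is
still owed. -/
theorem sum_code_of_treeState {x : ℕ → Bool} (hlow : ∀ c < 4, x c = false) {i : ℕ} (hi : 1 ≤ i)
    {b : Bool} (hb : treeState x i = some b) :
    (∑ c ∈ Finset.range (2 * i + 1), if x c = true then 1 else 0) + 1 + (if b then 0 else 1) = i := by
  induction i, hi using Nat.le_induction generalizing b with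
  | base =>
    simp only [treeState, Option.some.injEq] at hb
    subst hb
    simp
    exact fun c hc => hlow c (by omega)
  | succ i hi ih =>
    rw [treeState_succ x hi] at hb
    rw [show 2 * (i + 1) + 1 = 2 * i + 1 + 1 + 1 by ring, Finset.sum_range_succ,
      Finset.sum_range_succ]
    rcases ha : treeState x i with _ | _ | _
    · simp [ha, treeStep] at hb
    all_goals
      have h := ih ha
      rw [ha] at hb
      change treeStep _ _ (x (2 * i + 1 + 1)) = _ at hb
      revert hb
      cases x (2 * i + 1) <;> cases x (2 * i + 1 + 1) <;> cases b <;> simp [treeStep] <;>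
        simp at h <;> omega

/-- In the pending state the last block has no spoke and no edge to its left; if it is not continued
to the right either, it is cut off from `v_∞`. -/
theorem exists_block_of_treeState {x : ℕ → Bool} {i : ℕ} (hi : 1 ≤ i)
    (h : treeState x i = some false) :
    ∃ a, 2 ≤ a ∧ a ≤ i ∧ x (2 * a - 1) = false ∧ ∀ j, a ≤ j → j ≤ i → x (2 * j) = false := by
  induction i, hi using Nat.le_induction with
  | base => simp [treeState] at h
  | succ i hi ih =>
    rw [treeState_succ x hi] at h
    have hs : x (2 * i + 2) = false := by
      revert h
      rcases treeState x i with _ | _ | _ <;> cases x (2 * i + 1) <;> cases x (2 * i + 2) <;>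
        simp [treeStep]
    cases hp : x (2 * i + 1)
    · refine ⟨i + 1, by omega, le_rfl, hp, fun j h1 h2 => ?_⟩
      obtain rfl : j = i + 1 := by omega
      exact hs
    · have ha : treeState x i = some false := by
        revert h
        rw [hp, hs]
        rcases treeState x i with _ | _ | _ <;> simp [treeStep]
      obtain ⟨a, h1, h2, h3, h4⟩ := ih ha
      refine ⟨a, h1, by omega, h3, fun j hj hj' => ?_⟩
      rcases Nat.lt_or_ge i j with h | h
      · obtain rfl : j = i + 1 := by omega
        exact hs
      · exact h4 j hj h

theorem SimpleGraph.Reachable.mem_of_closed {V : Type*} {G : SimpleGraph V} {S : Set V}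
    (hS : ∀ a b, G.Adj a b → a ∈ S → b ∈ S) {u w : V} (h : G.Reachable u w) (hu : u ∈ S) :
    w ∈ S := by
  obtain ⟨p⟩ := h
  induction p with
  | nil => exact hu
  | cons hadj p ih => exact ih (hS _ _ hadj hu)

theorem not_reachable_top_of_treeState {n : ℕ} {x : ℕ → Bool} {i : ℕ} (hi : 2 ≤ i) (hin : i ≤ n)
    (h : treeState x i = some false) (hp : i < n → x (2 * i + 1) = false) :
    ¬ (codeGraph n x).Reachable (fanVertex n i) ⊤ := by
  obtain ⟨a, ha, hai, hx, hs⟩ := exists_block_of_treeState (by omega) h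
  intro hr
  have hmem := hr.mem_of_closed (S := {v | ∃ j, a ≤ j ∧ j ≤ i ∧ v = fanVertex n j}) ?_
    ⟨i, hai, le_rfl, rfl⟩
  · obtain ⟨j, h1, h2, h3⟩ := hmem
    exact fanVertex_ne_top (by omega) (by omega) h3.symm
  · rintro _ w hadj ⟨j, h1, h2, rfl⟩
    obtain ⟨c, hc, hc', hxc, e⟩ := codeGraph_adj.1 hadj
    obtain ⟨t, ht, htn, rfl | ⟨rfl, ht'⟩⟩ := even_or_odd_code hc hc'
    · rw [codeEdge_even, Sym2.eq_iff] at e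
      rcases e with ⟨e, -⟩ | ⟨e, -⟩
      · exact absurd e (fanVertex_ne_top (by omega) (by omega))
      · obtain rfl := (fanVertex_inj (by omega) (by omega) ht htn).1 e
        rw [hs j h1 h2] at hxc
        cases hxc
    · rw [codeEdge_odd, Sym2.eq_iff] at e
      rcases e with ⟨e, rfl⟩ | ⟨e, rfl⟩
      · obtain rfl := (fanVertex_inj (by omega) (by omega) ht htn).1 e
        refine ⟨j + 1, by omega, ?_, rfl⟩
        by_contra hj
        obtain rfl : j = i := by omega
        rw [hp (by omega)] at hxc
        cases hxc
      · obtain rfl := (fanVertex_inj (by omega) (by omega) (by omega) ht').1 e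
        refine ⟨t, ?_, by omega, rfl⟩
        by_contra hj
        obtain rfl : a = t + 1 := by omega
        change x (2 * t + 1) = false at hx
        rw [hx] at hxc
        cases hxc

theorem card_fanVertex {n : ℕ} (hn : 2 ≤ n) : Nat.card (FanVertex n) = n := by
  have : Fintype.card (Set.Icc 2 n) = n + 1 - 2 := by simp
  change Nat.card (Option (Set.Icc 2 n)) = n
  rw [Nat.card_eq_fintype_card, Fintype.card_option, this]
  omega

/-- Edges only need an upper bound, obtained by counting codes; connectedness supplies the lower
one. -/
theorem isTree_codeGraph {n : ℕ} (hn : 2 ≤ n) {x : ℕ → Bool} (hx : CodesTree n x) :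
    (codeGraph n x).IsTree := by
  classical
  have hc : (codeGraph n x).Connected := by
    refine SimpleGraph.connected_iff_exists_forall_reachable _ |>.2 ⟨⊤, fun w => ?_⟩
    rcases eq_top_or_eq_fanVertex w with rfl | ⟨i, hi, hin, rfl⟩
    · exact SimpleGraph.Reachable.refl _
    · rcases reachable_of_treeState hx.low (by omega)
        (fun c h1 h2 h3 => (codeEdge_mem h1 h2).2 h3) hx.state i hi hin with h | ⟨h, -⟩
      · exact h.symm
      · cases h
  refine SimpleGraph.isTree_iff_connected_and_card.2 ⟨hc, ?_⟩
  refine le_antisymm ?_ hc.card_vert_le_card_edgeSet_add_one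
  have hsum := sum_code_of_treeState hx.low (by omega) hx.state
  rw [if_pos rfl, add_zero, ← Finset.card_filter] at hsum
  rw [card_fanVertex hn]
  have hsub : (codeGraph n x).edgeSet ⊆
      (((Finset.range (2 * n + 1)).filter fun c => x c = true).image (codeEdge n) :
        Finset (Sym2 (FanVertex n))) := by
    intro e he
    obtain ⟨c, h1, h2, h3, rfl⟩ := mem_edgeSet_codeGraph.1 he
    exact Finset.mem_coe.2 (Finset.mem_image_of_mem _ (by simp [h3]; omega))
  have h1 := Set.ncard_le_ncard hsub (Finset.finite_toSet _)
  rw [Set.ncard_coe_finset] at h1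
  have h2 := h1.trans Finset.card_image_le
  rw [← Nat.card_coe_set_eq] at h2
  omega

/-- The first failure has one of two causes: a pending block is abandoned, or a vertex is attached
to a finished prefix and to `v_∞` as well. -/
theorem exists_treeState_eq_none {x : ℕ → Bool} {n : ℕ} (hn : 1 ≤ n)
    (h : treeState x n = none) :
    ∃ i, 1 ≤ i ∧ i < n ∧ (treeState x i = some false ∧ x (2 * i + 1) = false ∨
      treeState x i = some true ∧ x (2 * i + 1) = true ∧ x (2 * i + 2) = true) := by
  induction n, hn using Nat.le_induction with
  | base => simp [treeState] at h
  | succ n hn ih =>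
    rcases ha : treeState x n with _ | b
    · obtain ⟨i, h1, h2, h3⟩ := ih ha
      exact ⟨i, h1, by omega, h3⟩
    · refine ⟨n, hn, by omega, ?_⟩
      rw [treeState_succ x hn, ha] at h
      rw [ha]
      revert h
      cases b <;> cases x (2 * n + 1) <;> cases x (2 * n + 2) <;> simp [treeStep]

theorem codesTree_of_isTree {n : ℕ} (hn : 2 ≤ n) {x : ℕ → Bool} (hlow : ∀ c < 4, x c = false)
    (hhigh : ∀ c, 2 * n < c → x c = false) (h : (codeGraph n x).IsTree) : CodesTree n x := by
  refine ⟨?_, hlow, hhigh⟩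
  have hr := h.1.preconnected
  have two_le : ∀ {i}, 1 ≤ i → treeState x i = some false → 2 ≤ i := by
    intro i hi h
    by_contra hc
    obtain rfl : i = 1 := by omega
    simp [treeState] at h
  rcases hs : treeState x n with _ | _ | _
  · exfalso
    obtain ⟨i, h1, h2, ⟨h3, h4⟩ | ⟨h3, h4, h5⟩⟩ := exists_treeState_eq_none (by omega) hs
    · exact not_reachable_top_of_treeState (two_le h1 h3) h2.le h3 (fun _ => h4) (hr _ _)
    · have hi : 2 ≤ i := by
        by_contra hc
        rw [hlow _ (by omega)] at h4
        cases h4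
      have hmem : s(⊤, fanVertex n (i + 1)) ∈ (codeGraph n x).edgeSet := by
        rw [← codeEdge_even, codeEdge_mem (by omega) (by omega)]
        exact h5
      -- In a tree the spoke at `v_{i+1}` is a bridge, yet without it `v_{i+1}` still reaches `v_∞`
      -- through `v_i`.
      have hb := SimpleGraph.isAcyclic_iff_forall_isBridge.1 h.2 hmem
      rw [SimpleGraph.isBridge_iff] at hb
      have hH : ∀ c, 4 ≤ c → c < 2 * i + 2 → x c = true → codeEdge n c ∈
          ((codeGraph n x).deleteEdges {s(⊤, fanVertex n (i + 1))}).edgeSet := by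
        intro c hc hc' hx
        rw [SimpleGraph.edgeSet_deleteEdges]
        refine ⟨(codeEdge_mem hc (by omega)).2 hx, fun he => ?_⟩
        rw [Set.mem_singleton_iff, ← codeEdge_even] at he
        have := codeEdge_inj hc (by omega) (by omega) (by omega) he
        omega
      refine hb (SimpleGraph.Reachable.symm ?_)
      have hadj := hH (2 * i + 1) (by omega) (by omega) h4
      rw [codeEdge_odd, SimpleGraph.mem_edgeSet] at hadj
      refine hadj.symm.reachable.trans ?_
      rcases reachable_of_treeState hlow h1 (fun c k1 k2 k3 => hH c k1 (by omega) k3) h3 i hi le_rfl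
        with h | ⟨h, -⟩
      · exact h
      · cases h
  · exact absurd (hr _ _) (not_reachable_top_of_treeState hn le_rfl hs fun h => by omega)
  · rfl

theorem isSpanningTree_codeGraph_iff {n : ℕ} (hn : 2 ≤ n) {x : ℕ → Bool}
    (hlow : ∀ c < 4, x c = false) (hhigh : ∀ c, 2 * n < c → x c = false) :
    IsSpanningTree (fan n) (codeGraph n x) ↔ CodesTree n x :=
  ⟨fun h => codesTree_of_isTree hn hlow hhigh h.2,
    fun h => ⟨codeGraph_le_fan n x, isTree_codeGraph hn h⟩⟩

theorem IsSpanningTree.exists_codesTree {n : ℕ} (hn : 2 ≤ n) {T : SimpleGraph (FanVertex n)}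
    (hT : IsSpanningTree (fan n) T) : ∃ x, CodesTree n x ∧ codeGraph n x = T := by
  obtain ⟨x, h1, h2, rfl⟩ := exists_codeGraph_eq hT.1
  exact ⟨x, (isSpanningTree_codeGraph_iff hn h1 h2).1 hT, rfl⟩

/-! ## Moves of graphs and of codes -/

theorem codeEdge_dirCode {n i : ℕ} {d : Fin 3} (hi : 2 ≤ i) (h : 4 ≤ dirCode i d) :
    codeEdge n (dirCode i d) = s(fanVertex n i, dirVertex n i d) := by
  fin_cases d
  · obtain ⟨j, rfl⟩ : ∃ j, i = j + 1 := ⟨i - 1, by omega⟩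
    exact (codeEdge_odd n j).trans Sym2.eq_swap
  · exact codeEdge_odd n i
  · exact (codeEdge_even n i).trans Sym2.eq_swap

/-- Directions are numbered in the order `v_{i-1} < v_{i+1} < v_∞`. The bounds on codes exclude
`v_1` and `v_{n+1}`, which `fanVertex` would send to `v_∞`. -/
theorem dirVertex_lt {n i : ℕ} {d d' : Fin 3} (hi : 2 ≤ i) (hin : i ≤ n)
    (h : 4 ≤ dirCode i d) (h' : dirCode i d ≤ 2 * n) (k' : dirCode i d' ≤ 2 * n)
    (hd : d < d') : dirVertex n i d < dirVertex n i d' := by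
  rcases (by decide : ∀ d d' : Fin 3, d < d' → d = 0 ∧ d' = 1 ∨ d = 0 ∧ d' = 2 ∨ d = 1 ∧ d' = 2)
    d d' hd with
    ⟨rfl, rfl⟩ | ⟨rfl, rfl⟩ | ⟨rfl, rfl⟩ <;> simp only [dirCode] at h h' k'
  · exact fanVertex_lt (by omega) (by omega) (by omega)
  · exact lt_top_iff_ne_top.2 (fanVertex_ne_top (by omega) (by omega))
  · exact lt_top_iff_ne_top.2 (fanVertex_ne_top (by omega) (by omega))

theorem exists_dirVertex_of_adj {n i : ℕ} (hi : 2 ≤ i) (hin : i ≤ n) {w : FanVertex n}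
    (h : (fan n).Adj (fanVertex n i) w) :
    ∃ d, 4 ≤ dirCode i d ∧ dirCode i d ≤ 2 * n ∧ w = dirVertex n i d := by
  rw [fan_eq, codeGraph_adj] at h
  obtain ⟨c, hc, hc', -, e⟩ := h
  obtain ⟨t, ht, htn, rfl | ⟨rfl, ht'⟩⟩ := even_or_odd_code hc hc'
  · rw [codeEdge_even, Sym2.eq_iff] at e
    rcases e with ⟨e, -⟩ | ⟨e, e'⟩
    · exact absurd e (fanVertex_ne_top hi hin)
    · obtain rfl := (fanVertex_inj hi hin ht htn).1 e
      exact ⟨2, hc, hc', e'⟩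
  · rw [codeEdge_odd, Sym2.eq_iff] at e
    rcases e with ⟨e, e'⟩ | ⟨e, e'⟩
    · obtain rfl := (fanVertex_inj hi hin ht htn).1 e
      exact ⟨1, hc, hc', e'⟩
    · obtain rfl := (fanVertex_inj hi hin (by omega) ht').1 e
      exact ⟨0, hc, hc', e'⟩

theorem pivot_codeGraph {n i : ℕ} {d d' : Fin 3} {x y : ℕ → Bool} (hi : 2 ≤ i)
    (h4 : 4 ≤ dirCode i d) (hn : dirCode i d ≤ 2 * n) (h4' : 4 ≤ dirCode i d')
    (hn' : dirCode i d' ≤ 2 * n) (hm : IsCodeMove x y i d d') :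
    pivot (codeGraph n x) (fanVertex n i) (dirVertex n i d) (dirVertex n i d') =
      codeGraph n y := by
  have hdiag := codeEdge_not_isDiag h4' hn'
  rw [codeEdge_dirCode hi h4', Sym2.mk_isDiag_iff] at hdiag
  rw [← SimpleGraph.edgeSet_inj, pivot, SimpleGraph.edgeSet_sup, SimpleGraph.edgeSet_deleteEdges,
    SimpleGraph.edge, SimpleGraph.edgeSet_fromEdgeSet, ← codeEdge_dirCode hi h4,
    ← codeEdge_dirCode hi h4']
  ext e
  simp only [Set.mem_union, Set.mem_sdiff, Set.mem_singleton_iff, mem_edgeSet_codeGraph]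
  constructor
  · rintro (⟨⟨c, h1, h2, h3, rfl⟩, hne⟩ | ⟨rfl, -⟩)
    · refine ⟨c, h1, h2, ?_, rfl⟩
      rcases eq_or_ne c (dirCode i d') with rfl | hne'
      · exact hm.new_right
      · rwa [hm.same c (fun h => hne (h ▸ rfl)) hne']
    · exact ⟨_, h4', hn', hm.new_right, rfl⟩
  · rintro ⟨c, h1, h2, h3, rfl⟩
    rcases eq_or_ne c (dirCode i d') with rfl | hne'
    · exact Or.inr ⟨rfl, codeEdge_not_isDiag h4' hn'⟩
    · have hne : c ≠ dirCode i d := fun h => by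
        rw [h, hm.old_right] at h3
        cases h3
      exact Or.inl ⟨⟨c, h1, h2, by rwa [← hm.same c hne hne'], rfl⟩,
        fun he => hne (codeEdge_inj h1 h2 h4 hn he)⟩

theorem exists_isCodeMove {x : ℕ → Bool} {i : ℕ} {d d' : Fin 3} (h : x (dirCode i d) = true)
    (h' : x (dirCode i d') = false) : ∃ y, IsCodeMove x y i d d' := by
  have hne : dirCode i d ≠ dirCode i d' := fun e => by
    rw [e, h'] at h
    cases h
  refine ⟨Function.update (Function.update x (dirCode i d) false) (dirCode i d') true,
    h, ?_, h', by simp, fun c hc hc' => ?_⟩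
  · rw [Function.update_of_ne hne, Function.update_self]
  · rw [Function.update_of_ne hc', Function.update_of_ne hc]

theorem codeGraph_adj_dirVertex {n i : ℕ} {d : Fin 3} {x : ℕ → Bool} (hi : 2 ≤ i)
    (h4 : 4 ≤ dirCode i d) (hn : dirCode i d ≤ 2 * n) :
    (codeGraph n x).Adj (fanVertex n i) (dirVertex n i d) ↔ x (dirCode i d) = true := by
  rw [← SimpleGraph.mem_edgeSet, ← codeEdge_dirCode hi h4, codeEdge_mem h4 hn]

/-- A valid move at a vertex other than `v_∞` comes from a move of codes. -/
theorem IsValidMove.exists_isCodeMove {n : ℕ} (hn : 2 ≤ n) {gen : List (SimpleGraph (FanVertex n))}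
    {x : ℕ → Bool} (hx : CodesTree n x) {u v w : FanVertex n}
    (h : IsValidMove (fan n) gen (codeGraph n x) u v w) (hu : u ≠ ⊤) :
    ∃ i d d' y, 2 ≤ i ∧ i ≤ n ∧ (4 ≤ dirCode i d ∧ dirCode i d ≤ 2 * n) ∧
      (4 ≤ dirCode i d' ∧ dirCode i d' ≤ 2 * n) ∧ u = fanVertex n i ∧ v = dirVertex n i d ∧
      w = dirVertex n i d' ∧ IsCodeMove x y i d d' ∧ CodesTree n y ∧ codeGraph n y ∉ gen := by
  obtain ⟨i, hi, hin, rfl⟩ := (eq_top_or_eq_fanVertex u).resolve_left hu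
  obtain ⟨h1, h2, h3, h4, h5⟩ := h
  obtain ⟨d, hd, hd', rfl⟩ := exists_dirVertex_of_adj hi hin (codeGraph_le_fan n x h1)
  obtain ⟨d', he, he', rfl⟩ := exists_dirVertex_of_adj hi hin h2
  rw [codeGraph_adj_dirVertex hi hd hd'] at h1
  rw [codeGraph_adj_dirVertex hi he he', Bool.not_eq_true] at h3
  obtain ⟨y, hy⟩ := _root_.exists_isCodeMove h1 h3
  rw [pivot_codeGraph hi hd hd' he he' hy] at h4 h5
  refine ⟨i, d, d', y, hi, hin, ⟨hd, hd'⟩, ⟨he, he'⟩, rfl, rfl, rfl, hy, ?_, h5⟩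
  refine (isSpanningTree_codeGraph_iff hn (fun c hc => ?_) fun c hc => ?_).1 h4
  · rw [hy.same c (by omega) (by omega), hx.low c hc]
  · rw [hy.same c (by omega) (by omega), hx.high c hc]

/-! ## The greedy listing -/

theorem nextTree_codeGraph {n : ℕ} (hn : 2 ≤ n) {gen : List (SimpleGraph (FanVertex n))}
    {x y : ℕ → Bool} (hx : CodesTree n x) (hy : CodesTree n y) {i : ℕ} {d d' : Fin 3} (hi : 2 ≤ i)
    (hin : i ≤ n) (hm : IsCodeMove x y i d d') (hgen : codeGraph n y ∉ gen)
    (hF : SmallerMovesIn n x i d d' {z | codeGraph n z ∈ gen}) :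
    nextTree (fan n) gen (codeGraph n x) = some (codeGraph n y) := by
  obtain ⟨h4, h4n⟩ := hx.code_mem hm.old_left
  obtain ⟨k4, k4n⟩ := hy.code_mem hm.new_right
  have hp := pivot_codeGraph hi h4 h4n k4 k4n hm
  have hmem : toLex (fanVertex n i, toLex (dirVertex n i d, dirVertex n i d')) ∈
      validMoves (fan n) gen (codeGraph n x) := by
    rw [mem_validMoves]
    change IsValidMove _ _ _ (fanVertex n i) (dirVertex n i d) (dirVertex n i d')
    refine ⟨(codeGraph_adj_dirVertex hi h4 h4n).2 hm.old_left, ?_, ?_, ?_, ?_⟩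
    · rw [fan_eq, codeGraph_adj_dirVertex hi k4 k4n]
    · rw [codeGraph_adj_dirVertex hi k4 k4n, hm.new_left]
      simp
    · rw [hp]
      exact (isSpanningTree_codeGraph_iff hn hy.low hy.high).2 hy
    · rwa [hp]
  have hne : (validMoves (fan n) gen (codeGraph n x)).Nonempty := ⟨_, hmem⟩
  have hmin : (validMoves (fan n) gen (codeGraph n x)).min' hne =
      toLex (fanVertex n i, toLex (dirVertex n i d, dirVertex n i d')) := by
    rw [Finset.min'_eq_iff]
    refine ⟨hmem, fun b hb => ?_⟩
    by_contra hlt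
    rw [not_le] at hlt
    rw [mem_validMoves] at hb
    obtain ⟨u, v, w⟩ := b
    change toLex (u, toLex (v, w)) < _ at hlt
    change IsValidMove _ _ _ u v w at hb
    rw [Prod.Lex.toLex_lt_toLex, Prod.Lex.toLex_lt_toLex] at hlt
    -- As `v_∞` is the largest vertex, no smaller triple pivots there. This is why code moves only
    -- need pivots `v_i`.
    have hu : u ≠ ⊤ := by
      have h1 := (fanVertex_ne_top hi hin).lt_top
      rcases hlt with h | ⟨h, -⟩
      · exact (lt_trans h h1).ne
      · exact (h.trans_lt h1).ne
    obtain ⟨j, e, e', z, hj, hjn, ⟨he, hen⟩, ⟨he', hen'⟩, rfl, rfl, rfl, hz, hzt, hzg⟩ :=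
      hb.exists_isCodeMove hn hx hu
    refine hzg (hF j e e' z ?_ hz hzt)
    dsimp only at hlt
    rcases hlt with h | ⟨h, h'⟩
    · left
      by_contra hij
      rcases eq_or_lt_of_le (not_lt.1 hij) with rfl | hij
      · exact lt_irrefl _ h
      · exact lt_asymm h (fanVertex_lt hi hij hjn)
    · obtain rfl := (fanVertex_inj hj hjn hi hin).1 h
      refine Or.inr ⟨rfl, ?_⟩
      rcases lt_trichotomy e d with hed | rfl | hed
      · exact Or.inl hed
      · refine Or.inr ⟨rfl, ?_⟩
        have h'' := h'.resolve_left (lt_irrefl _)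
        rcases lt_trichotomy e' d' with hed' | rfl | hed'
        · exact hed'
        · exact absurd h''.2 (lt_irrefl _)
        · exact absurd h''.2 (lt_asymm (dirVertex_lt hi hin k4 k4n hen' hed'))
      · have hlt := dirVertex_lt hi hin h4 h4n hen hed
        rcases h' with h' | ⟨h', -⟩
        · exact absurd h' (lt_asymm hlt)
        · exact absurd h' hlt.ne'
  rw [nextTree, dif_pos hne]
  dsimp only
  rw [hmin]
  exact congrArg some hp

theorem greedyAfter_of_nextTree_eq_some {V : Type*} [LinearOrder V] [Fintype V]
    {G : SimpleGraph V} {gen : List (SimpleGraph V)} {T T' : SimpleGraph V}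
    (h : nextTree G gen T = some T') :
    greedyAfter G gen T = T' :: greedyAfter G (T' :: gen) T' := by
  rw [greedyAfter]
  split <;> simp_all

theorem greedyAfter_of_nextTree_eq_none {V : Type*} [LinearOrder V] [Fintype V]
    {G : SimpleGraph V} {gen : List (SimpleGraph V)} {T : SimpleGraph V}
    (h : nextTree G gen T = none) : greedyAfter G gen T = [] := by
  rw [greedyAfter]
  split <;> simp_all

namespace TwoWayListing

variable {n : ℕ} {T T' : ℕ → Bool} {l : List (ℕ → Bool)}
  {ms : List (FanVertex n × FanVertex n × FanVertex n)} {B A : Set (ℕ → Bool)}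

theorem foldl_pivot (h : TwoWayListing n T T' l ms B A) :
    ms.foldl (fun T m => pivot T m.1 m.2.1 m.2.2) (codeGraph n T) = codeGraph n T' := by
  induction h with
  | single hT => rfl
  | join h₁ h₂ hi hin hm hdis hF hR ih₁ ih₂ =>
    obtain ⟨h4, h4n⟩ := (h₁.codesTree _ h₁.end_mem).code_mem hm.old_left
    obtain ⟨k4, k4n⟩ := (h₂.codesTree _ h₂.start_mem).code_mem hm.new_right
    rw [List.foldl_append, ih₁, List.foldl_cons, pivot_codeGraph hi h4 h4n k4 k4n hm, ih₂]

/-- At each join, smaller moves lead to `B` or to the earlier half, all in `gen` by then, while the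
next tree is new. Keeping `gen` general lets the two halves be run one after the other. -/
theorem greedyAfter_eq (hn : 2 ≤ n) (h : TwoWayListing n T T' l ms B A)
    (gen : List (SimpleGraph (FanVertex n))) (hB : ∀ x ∈ B, codeGraph n x ∈ gen)
    (hT : codeGraph n T ∈ gen) (hl : ∀ x ∈ l, x ≠ T → codeGraph n x ∉ gen) :
    greedyAfter (fan n) gen (codeGraph n T) = (l.map (codeGraph n)).tail ++
      greedyAfter (fan n) ((l.map (codeGraph n)).tail.reverse ++ gen) (codeGraph n T') := by
  induction h generalizing gen with
  | single hT => simp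
  | @join T₁ T₂ T₃ T₄ l₁ l₂ ms₁ ms₂ B A i d d' h₁ h₂ hi hin hm hdis hF hR ih₁ ih₂ =>
    have c₁ := h₁.codesTree
    have c₂ := h₂.codesTree
    have he := h₁.end_mem
    obtain ⟨t₁, rfl⟩ := h₁.start_cons
    obtain ⟨t₂, rfl⟩ := h₂.start_cons
    simp only [List.map_cons, List.tail_cons, List.map_append, List.cons_append] at ih₁ ih₂ ⊢
    rw [ih₁ gen hB hT fun x hx hne => hl x (by simp at hx ⊢; tauto) hne]
    have hnew : ∀ x ∈ T₃ :: t₂, codeGraph n x ∉ (t₁.map (codeGraph n)).reverse ++ gen := by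
      intro x hx hmem
      rw [List.mem_append, List.mem_reverse, List.mem_map] at hmem
      rcases hmem with ⟨y, hy, e⟩ | hmem
      · obtain rfl := (c₁ y (List.mem_cons_of_mem _ hy)).ext_codeGraph (c₂ x hx) e
        exact hdis (List.mem_cons_of_mem _ hy) hx
      · refine hl x (List.mem_append_right _ hx) (fun e => ?_) hmem
        subst e
        exact hdis List.mem_cons_self hx
    have hold : ∀ x ∈ B ∪ {x | x ∈ T₁ :: t₁},
        codeGraph n x ∈ (t₁.map (codeGraph n)).reverse ++ gen := by
      intro x hx
      rw [List.mem_append, List.mem_reverse]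
      rcases hx with hx | hx
      · exact Or.inr (hB x hx)
      · rcases List.mem_cons.1 hx with rfl | hx
        · exact Or.inr hT
        · exact Or.inl (List.mem_map_of_mem hx)
    rw [greedyAfter_of_nextTree_eq_some (nextTree_codeGraph hn (c₁ _ he) (c₂ _ List.mem_cons_self)
      hi hin hm (hnew _ List.mem_cons_self) fun j e e' x h1 h2 h3 => hold x (hF j e e' x h1 h2 h3)),
      ih₂ _ (fun x hx => List.mem_cons_of_mem _ (hold x hx)) List.mem_cons_self]
    · simp
    · intro x hx hne hmem
      rcases List.mem_cons.1 hmem with e | hmem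
      · exact hne ((c₂ x hx).ext_codeGraph (c₂ _ List.mem_cons_self) e)
      · exact hnew x hx hmem

theorem greedy_eq (hn : 2 ≤ n) (h : TwoWayListing n T T' l ms ∅ A)
    (hl : ∀ x, CodesTree n x → x ∈ l) :
    greedy (fan n) (codeGraph n T) = l.map (codeGraph n) := by
  have c := h.codesTree
  have hg := h.greedyAfter_eq hn [codeGraph n T] (by simp) (by simp) ?_
  · obtain ⟨t, rfl⟩ := h.start_cons
    rw [greedy, hg]
    -- All spanning trees are listed by now, so the algorithm halts.
    have hnone : nextTree (fan n)
        ((((T :: t).map (codeGraph n)).tail).reverse ++ [codeGraph n T]) (codeGraph n T') = none := by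
      rw [nextTree, dif_neg]
      rintro ⟨m, hm⟩
      obtain ⟨-, -, -, hs, hng⟩ := mem_validMoves.1 hm
      obtain ⟨x, hx, e⟩ := hs.exists_codesTree hn
      refine hng ?_
      rw [← e]
      have := List.mem_map_of_mem (f := codeGraph n) (hl x hx)
      simpa [or_comm] using this
    rw [greedyAfter_of_nextTree_eq_none hnone]
    simp
  · intro x hx hne hmem
    exact hne ((c x hx).ext_codeGraph (c T h.start_mem) (List.mem_singleton.1 hmem))

end TwoWayListing

theorem exists_twoWayListing_genMoves {n : ℕ} (hn : 2 ≤ n) :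
    ∃ T' l, TwoWayListing n (fanPathCode n) T' l (genMoves n n true false) ∅ ∅ ∧
      ∀ x, CodesTree n x → x ∈ l := by
  have hup : AgreeUpTo (2 * n) (fanPathCode n) pathCode := fun c hc => if_pos hc
  have hT : CodesTree n (fanPathCode n) := by
    refine ⟨treeState_pathCode hn hup, fun c hc => ?_, fun c hc => if_neg (by omega)⟩
    rw [hup c (by omega)]
    simp [pathCode]; omega
  obtain ⟨l, hl, mem⟩ := (listings n n hn le_rfl).1 (fanPathCode n)
    (fun c => if c ≤ 2 * n then lastCode n c else false) hT hup (fun c hc => if_pos hc)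
    (fun c hc => (if_neg (by omega)).trans (if_neg (by omega)).symm)
  refine ⟨_, l, hl.mono ?_ subset_rfl, fun x hx => (mem x).2 ⟨hx, fun c hc => ?_⟩⟩
  -- For `k = n` the exceptional set is empty: code `2n + 1` belongs to no edge of the fan.
  · rintro x ⟨-, hx, h, -⟩
    rw [hx.high _ (by omega)] at h
    cases h
  · rw [hx.high c hc, hT.high c hc]

theorem corollary1 (n : ℕ) (hn : 2 ≤ n) :
    (greedy (fan n) (fanPath n)).getLast? = some (lastTree n) ∧
      greedy (fan n) (lastTree n) = (greedy (fan n) (fanPath n)).reverse := by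
  obtain ⟨T', l, hl, mem⟩ := exists_twoWayListing_genMoves hn
  have hlast : lastTree n = codeGraph n T' := by
    rw [lastTree, ← hl.foldl_pivot, ← fanPath_eq hn]
    exact List.getLast_scanl _
  rw [hlast, fanPath_eq hn, hl.greedy_eq hn mem,
    hl.rev.greedy_eq hn fun x hx => List.mem_reverse.2 (mem x hx), List.getLast?_map,
    hl.getLast?_eq, List.map_reverse]
  exact ⟨rfl, rfl⟩
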